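/- **Model.** Let $n\ge 1$ and $V=[n]=\{1,\dots,n\}$, read modulo $n$. Processors with ids in $V$ form an asynchronous unidirectional ring: processor $i$ sends messages (natural numbers, of unlimited size) to processor $i+1$ over a reliable FIFO link. Each processor has an infinite random string of independent uniform symbols from $[n]$, independent of the strings of the other processors. A strategy is a deterministic (measurable) function that maps the id, the random string and the list of messages received so far to a finite list of messages to send and a decision whether to go on, to terminate with an output in $V$, or to abort (output $\bot$). It is applied once when the processor is activated at the beginning and then at each receipt of a message; a processor that has terminated does nothing more. A protocol assigns a strategy to each processor. An oblivious schedule is a sequence of links, fixed in advance and serving every link infinitely often; at each step the oldest message in transit on the given link, if there is one, is delivered. The outcome of an execution is $o\in V$ if all processors terminate with output $o$, and $\mathtt{FAIL}$ if there is no such $o$. A rational utility is a function $u:V\cup\{\mathtt{FAIL}\}\to[0,1]$ with $u(\mathtt{FAIL})=0$. A deviation of a coalition $C\subseteq V$ from a protocol $P$ is a protocol $D$ in which each processor outside $C$ has the same strategy as in $P$, and the processors in $C$ have arbitrary strategies. $P$ is $\varepsilon$-$k$-resilient if for every oblivious schedule, all rational utilities $(u_p)_{p\in V}$, every coalition $C$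 with $|C|=k$ and every deviation $D$ of $C$ from $P$ there is $p\in C$ with $E_D[u_p]\le E_P[u_p]+\varepsilon$. **The protocol $\mathtt{A\text{-}LEAD}^{\mathtt{uni}}$.** Each processor $i$ has a secret $d_i$, uniform in $[n]$ (the first symbol of its random string), and reduces incoming messages modulo $n$. Processor $1$, the origin, sends $d_1$ when it is activated, and forwards each of its first $n-1$ incoming messages immediately. Every other processor sends nothing when it is activated and holds a buffer, initially containing $d_i$; at each incoming message it sends the content of the buffer and then stores the message in the buffer. After its $n$-th incoming message every processor $i$ terminates: with output the sum modulo $n$ of its $n$ incoming messages if the $n$-th of them equals $d_i$, and with output $\bot$ otherwise. **Theorem.** For every $n\ge1$, with $k_0:=\frac14 n^{1/4}$, the protocol $\mathtt{A\text{-}LEAD}^{\mathtt{uni}}$ on the ring of $n$ processors is $\varepsilon$-$k$-resilient for every integer $k$ with $1\le k\le k_0$ and every real $\varepsilon\ge n^{3}\,n^{-k_0}$. -/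

import Mathlib

open MeasureTheory

namespace RingElection

/-- The set of ids, which is also the set of valid outcomes and of secret values: the residues
modulo `n`, where the residue of `n` is `0`. The successor of `i` on the ring is `i + 1`. -/
abbrev V (n : ℕ) : Type := ZMod n

/-- The origin is processor `1`. -/
def origin (n : ℕ) : V n := 1

/-- The infinite random string of one processor. -/
abbrev RandomString (n : ℕ) : Type := ℕ → V n

/-- The law of the local randomization of all processors: all the symbols of all the random
strings are independent and uniform. -/
noncomputable def randomness (n : ℕ) [NeZero n] : Measure (V n → RandomString n) :=
  Measure.pi fun _ => Measure.infinitePi fun _ => (PMF.uniformOfFintype (V n)).toMeasure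

/-- What a processor does at one event (its activation, or the receipt of a message). Messages are
natural numbers, of unlimited size.
* `send`: the messages that it sends, in this order;
* `output`: `none` if it goes on; `some (some o)` if it then terminates with output `o ∈ V`;
  `some none` if it then aborts, i.e. terminates with output `⊥` (or with any value outside `V`). -/
@[ext] structure Action (n : ℕ) where
  send : List ℕ
  output : Option (Option (V n))

/-- A strategy: the action of a processor as a function of its id, its random string and its
history, the list of all messages received so far (oldest first, including the one that is being
received now). The empty history is the activation at the beginning of the execution. -/
structure Strategy (n : ℕ) where
  act : V n → RandomString n → List ℕ → Action n
  measurable_act : ∀ (i : V n) (h : List ℕ) (a : Action n), MeasurableSet {ω | act i ω h = a}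

/-- A protocol: a strategy for each processor. -/
abbrev Protocol (n : ℕ) : Type := V n → Strategy n

/-- A configuration of the ring. -/
structure Config (n : ℕ) where
  /-- the messages received so far by each processor, oldest first -/
  received : V n → List ℕ
  /-- the messages in transit on the (FIFO) link that enters each processor, oldest first -/
  pending : V n → List ℕ
  /-- the output of each processor, `none` while it has not terminated -/
  output : V n → Option (Option (V n))

/-- The configuration after the activation of the processors. Every processor is activated once at
the beginning; a strategy under which only the origin starts spontaneously is one that sends nothing
upon the activation of any other processor. -/
def Config.initial {n : ℕ} (P : Protocol n) (ω : V n → RandomString n) : Config n where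
  received := fun _ => []
  pending := fun i => ((P (i - 1)).act (i - 1) (ω (i - 1)) []).send
  output := fun i => ((P i).act i (ω i) []).output

/-- The oldest message on the link entering `i` is delivered, if there is one and if `i` has not
terminated; then `i` acts, and its messages join the link that enters `i + 1`. -/
def Config.deliver {n : ℕ} (P : Protocol n) (ω : V n → RandomString n) (i : V n)
    (c : Config n) : Config n :=
  match c.output i, c.pending i with
  | none, m :: rest =>
    let h := c.received i ++ [m]
    let a := (P i).act i (ω i) h
    let p := Function.update c.pending i rest
    { received := Function.update c.received i h
      pending := Function.update p (i + 1) (p (i + 1) ++ a.send)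
      output := Function.update c.output i a.output }
  | _, _ => c

/-- An oblivious message schedule: a sequence, fixed in advance, of the links on which the next
delivery takes place (steps at which that link is empty are void). Every message arrives, since
every link is served infinitely often. -/
structure Schedule (n : ℕ) where
  link : ℕ → V n
  fair : ∀ (i : V n) (t : ℕ), ∃ s, t ≤ s ∧ link s = i

/-- The configuration after `t` steps. -/
def run {n : ℕ} (P : Protocol n) (σ : Schedule n) (ω : V n → RandomString n) : ℕ → Config n
  | 0 => Config.initial P ω
  | t + 1 => (run P σ ω t).deliver P ω (σ.link t)

/-- All processors terminate with output `o`. -/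
def AllOutput {n : ℕ} (P : Protocol n) (σ : Schedule n) (ω : V n → RandomString n) (o : V n) :
    Prop :=
  ∀ i, ∃ t, (run P σ ω t).output i = some (some o)

open Classical in
/-- The outcome of an execution: `some o` if all processors terminate with output `o`, and
`none`, standing for `FAIL`, if there is no such `o`. -/
noncomputable def outcome {n : ℕ} (P : Protocol n) (σ : Schedule n) (ω : V n → RandomString n) :
    Option (V n) :=
  if h : ∃ o, AllOutput P σ ω o then some h.choose else none

/-- A rational utility: values in `[0, 1]`, and value `0` at `FAIL`. -/
def IsRationalUtility {n : ℕ} (u : Option (V n) → ℝ) : Prop :=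
  (∀ o, 0 ≤ u o ∧ u o ≤ 1) ∧ u none = 0

/-- The expected utility. -/
noncomputable def expectedUtility {n : ℕ} [NeZero n] (P : Protocol n) (σ : Schedule n)
    (u : Option (V n) → ℝ) : ℝ :=
  ∫ ω, u (outcome P σ ω) ∂(randomness n)

/-- `D` is an adversarial deviation of the coalition `C` from `P`. -/
def IsDeviation {n : ℕ} (P : Protocol n) (C : Finset (V n)) (D : Protocol n) : Prop :=
  ∀ i, i ∉ C → D i = P i

/-- `P` is `ε`-`k`-resilient. -/
def IsResilient {n : ℕ} [NeZero n] (ε : ℝ) (k : ℕ) (P : Protocol n) : Prop :=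
  ∀ (σ : Schedule n) (u : V n → Option (V n) → ℝ), (∀ p, IsRationalUtility (u p)) →
    ∀ C : Finset (V n), C.card = k → ∀ D : Protocol n, IsDeviation P C D →
      ∃ p ∈ C, expectedUtility D σ (u p) ≤ expectedUtility P σ (u p) + ε

/-- The strategy of `A-LEAD^uni` for the processor `i` with secret value `d`, where `h` is the
history. Incoming messages are reduced modulo `n`.
* The origin sends `d` when it is activated and then forwards its first `n - 1` messages.
* A normal processor keeps a buffer, which contains `d` at first. For each incoming message, it
  sends the content of the buffer and then stores the message in the buffer.
* With its `n`-th message a processor terminates: with the sum of its `n` messages if the last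
  one is `d`, and with `⊥` otherwise. -/
def aLeadAct (n : ℕ) (i : V n) (d : V n) (h : List ℕ) : Action n :=
  let values : List (V n) := h.map fun m => (m : V n)
  { send :=
      if i = origin n then
        if h.length < n then [(values.getLastD d).val] else []
      else
        if h = [] then [] else [(values.dropLast.getLastD d).val]
    output :=
      if h.length = n then
        if values.getLast? = some d then some (some values.sum) else some none
      else none }

/-- The strategy of `A-LEAD^uni`; the secret value is the first symbol of the random string. -/
def aLeadStrategy (n : ℕ) : Strategy n where
  act i ω h := aLeadAct n i (ω 0) h
  measurable_act i h a := by
    have hm : Measurable fun ω : RandomString n => ω 0 := measurable_pi_apply 0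
    have hs : MeasurableSet {d : V n | aLeadAct n i d h = a} := MeasurableSpace.measurableSet_top
    exact hm hs

/-- The (symmetric) protocol `A-LEAD^uni`. -/
def aLeadUni (n : ℕ) : Protocol n := fun _ => aLeadStrategy n

end RingElection

/-!
The idea: a coalition of `k` processors can neither speed up the ring much nor, without speeding it
up, learn the secrets of a long honest segment before it is committed to the outcome.

Since a processor acts only on its own string and on the messages that it has received, it is a
monotone stream transducer (`transduce`), and a row of processors is the composite transducer
(`relay`). What a processor receives in a run is always a prefix of what such a composite emits
(`received_prefix_relay`), whatever the schedule. Honest processors emit their secret followed by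
what they receive; in a successful run each of them receives exactly `n` symbols, which sum up to the
outcome and end with its own secret. Hence, with the strings of the coalition fixed, the `n` symbols
received by one honest processor determine all the secrets (`secret_eq_of_residues_eq`).

*Rushing is improbable.* Suppose that the members of the coalition between two honest processors
have delivered more than `r + g` symbols when they had received only `r`. The delivered symbols are
a function of these `r`, and the `n - r - g - 1` symbols that follow complete the `n` symbols which
determine all the secrets. So at most `n ^ (n - g - 1)` of the `n ^ (n - k)` vectors of secrets admit
such a rush (`card_le_of_rushes`).

*Without rushing, the outcome is unpredictable.* If nobody rushes, the numbers of messages received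
by any two honest processors differ by at most `g * k + 1` at any time
(`NoRush.length_received_le`). Consequently a secret `d` of a processor `s` influences what is
received further along the ring only after a delay of one message per honest processor, less
`g * k + 1` per row of members of the coalition (`NoRush.take_received_eq`). When `s` begins an
honest segment that is longer than the total loss, all the symbols which enter the segment and on
which the outcome depends, besides the secrets of the segment, are independent of `d`; the outcome
is `d` plus something independent of `d` (`NoRush.secret_eq`). So, with everything but `d` fixed, at
most one value of `d` leads to a given outcome.

Both counts turn into probabilities because the randomness is invariant under shifts of the secrets
(`card_mul_randomness`). Altogether each outcome has probability at most `1 / n` plus a small error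
under a deviation (`measure_allOutput_le`), and at least `1 / n` in the honest execution, where the
outcome is the sum of all secrets (`allOutput_aLeadUni`).
-/

namespace RingElection

/-! ### Processors as stream transducers -/

/-- The messages that a processor with actions `A` sends from the moment when its history is `h`,
when the messages `w` are then offered to it: it reads them one by one, until it terminates. -/
def emitFrom {n : ℕ} (A : List ℕ → Action n) : List ℕ → List ℕ → List ℕ
  | h, [] => (A h).send
  | h, m :: w => (A h).send ++ if (A h).output.isNone then emitFrom A (h ++ [m]) w else []

theorem emitFrom_prefix {n : ℕ} (A : List ℕ → Action n) {w w' : List ℕ} (hw : w <+: w')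
    (h : List ℕ) : emitFrom A h w <+: emitFrom A h w' := by
  induction w generalizing h w' with
  | nil =>
    cases w' with
    | nil => exact List.prefix_rfl
    | cons m w' => exact List.prefix_append _ _
  | cons m w ih =>
    obtain ⟨v, rfl⟩ := hw
    simp only [List.cons_append, emitFrom]
    split_ifs
    · exact (List.prefix_append_right_inj _).2 (ih (List.prefix_append _ _) _)
    · exact List.prefix_rfl

theorem emitFrom_concat {n : ℕ} (A : List ℕ → Action n) (w : List ℕ) (m : ℕ) (h : List ℕ)
    (hlive : ∀ v, v <+: w → (A (h ++ v)).output = none) :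
    emitFrom A h (w ++ [m]) = emitFrom A h w ++ (A (h ++ w ++ [m])).send := by
  induction w generalizing h with
  | nil =>
    have := hlive [] List.prefix_rfl
    simp only [List.append_nil] at this
    simp [emitFrom, this]
  | cons a w ih =>
    have h0 := hlive [] (List.nil_prefix)
    simp only [List.append_nil] at h0
    have := ih (h ++ [a]) fun v hv => by
      have := hlive (a :: v) (by simpa using hv)
      simpa using this
    simp [emitFrom, h0, this]

/-- The stream function of processor `i`: all the messages that `i` sends when the messages `w` are
offered to it. -/
def transduce {n : ℕ} (P : Protocol n) (ω : V n → RandomString n) (i : V n) (w : List ℕ) :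
    List ℕ :=
  emitFrom ((P i).act i (ω i)) [] w

theorem transduce_prefix {n : ℕ} (P : Protocol n) (ω : V n → RandomString n) (i : V n)
    {w w' : List ℕ} (hw : w <+: w') : transduce P ω i w <+: transduce P ω i w' :=
  emitFrom_prefix _ hw _

/-- The composite stream function of the `j` consecutive processors `a, …, a + j - 1`. -/
def relay {n : ℕ} (P : Protocol n) (ω : V n → RandomString n) (a : V n) (w : List ℕ) : ℕ → List ℕ
  | 0 => w
  | j + 1 => transduce P ω (a + j) (relay P ω a w j)

/-! ### Invariants of a run -/

/-- What holds of every reachable configuration. All that `i` has sent is either received by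
`i + 1` or in transit; the output of `i` is the one that its last action prescribes; and `i` had not
terminated before. -/
structure Config.Reachable {n : ℕ} (P : Protocol n) (ω : V n → RandomString n) (c : Config n) :
    Prop where
  sent : ∀ i, c.received (i + 1) ++ c.pending (i + 1) = transduce P ω i (c.received i)
  out : ∀ i, c.output i = ((P i).act i (ω i) (c.received i)).output
  live : ∀ i v, v <+: c.received i → v ≠ c.received i → ((P i).act i (ω i) v).output = none

theorem deliver_of_output {n : ℕ} (P : Protocol n) (ω : V n → RandomString n) (i : V n)
    (c : Config n) (h : c.output i ≠ none) : c.deliver P ω i = c := by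
  unfold Config.deliver
  split
  · contradiction
  · rfl

theorem deliver_of_pending {n : ℕ} (P : Protocol n) (ω : V n → RandomString n) (i : V n)
    (c : Config n) (h : c.pending i = []) : c.deliver P ω i = c := by
  unfold Config.deliver
  split
  · simp_all
  · rfl

theorem deliver_cons {n : ℕ} (P : Protocol n) (ω : V n → RandomString n) (i : V n)
    (c : Config n) {m : ℕ} {rest : List ℕ} (h : c.output i = none)
    (hp : c.pending i = m :: rest) :
    c.deliver P ω i =
      { received := Function.update c.received i (c.received i ++ [m])
        pending := Function.update (Function.update c.pending i rest) (i + 1)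
          (Function.update c.pending i rest (i + 1) ++
            ((P i).act i (ω i) (c.received i ++ [m])).send)
        output := Function.update c.output i
          ((P i).act i (ω i) (c.received i ++ [m])).output } := by
  unfold Config.deliver
  split
  · simp_all
  · simp_all

theorem Config.Reachable.deliver {n : ℕ} {P : Protocol n} {ω : V n → RandomString n}
    {c : Config n} (hc : c.Reachable P ω) (i : V n) : (c.deliver P ω i).Reachable P ω := by
  by_cases ho : c.output i = none
  swap
  · rwa [deliver_of_output P ω i c ho]
  rcases hp : c.pending i with _ | ⟨m, rest⟩
  · rwa [deliver_of_pending P ω i c hp]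
  rw [deliver_cons P ω i c ho hp]
  have hlive : ∀ v, v <+: c.received i → ((P i).act i (ω i) v).output = none := by
    intro v hv
    by_cases hv' : v = c.received i
    · rw [hv', ← hc.out, ho]
    · exact hc.live i v hv hv'
  have hemit : transduce P ω i (c.received i ++ [m]) = transduce P ω i (c.received i) ++
      ((P i).act i (ω i) (c.received i ++ [m])).send := by
    have := emitFrom_concat ((P i).act i (ω i)) (c.received i) m [] (by simpa using hlive)
    simpa [transduce] using this
  refine ⟨fun j => ?_, fun j => ?_, fun j v hv hne => ?_⟩
  · have hs := hc.sent j
    by_cases hj : j = i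
    · subst hj
      by_cases h1 : j + 1 = j
      · rw [h1] at hs ⊢
        simp only [Function.update_self]
        rw [hemit, ← hs, hp]
        simp
      · simp only [Function.update_self, Function.update_of_ne h1]
        rw [hemit, ← hs]
        simp
    · have h2 : j + 1 ≠ i + 1 := fun h => hj (add_right_cancel h)
      simp only [Function.update_of_ne h2, Function.update_of_ne hj]
      by_cases h1 : j + 1 = i
      · subst h1
        simp only [Function.update_self]
        rw [← hs, hp]
        simp
      · simp only [Function.update_of_ne h1]
        exact hs
  · by_cases hj : j = i
    · subst hj; simp
    · simp only [Function.update_of_ne hj]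
      exact hc.out j
  · by_cases hj : j = i
    · subst hj
      simp only [Function.update_self] at hv hne
      rcases List.prefix_concat_iff.1 hv with h | h
      · exact absurd h hne
      · exact hlive v h
    · simp only [Function.update_of_ne hj] at hv hne
      exact hc.live j v hv hne

theorem run_reachable {n : ℕ} (P : Protocol n) (σ : Schedule n) (ω : V n → RandomString n)
    (t : ℕ) : (run P σ ω t).Reachable P ω := by
  induction t with
  | zero =>
    refine ⟨fun i => ?_, fun i => rfl, fun i v hv hne => ?_⟩
    · simp [run, Config.initial, transduce, emitFrom]
    · exact absurd (List.prefix_nil.1 hv) hne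
  | succ t ih => exact ih.deliver _

theorem received_succ {n : ℕ} (P : Protocol n) (σ : Schedule n) (ω : V n → RandomString n)
    (t : ℕ) (i : V n) :
    (run P σ ω (t + 1)).received i = (run P σ ω t).received i ∨
      σ.link t = i ∧ ∃ m, (run P σ ω (t + 1)).received i = (run P σ ω t).received i ++ [m] := by
  simp only [run]
  set c := run P σ ω t
  by_cases ho : c.output (σ.link t) = none
  swap
  · rw [deliver_of_output P ω _ c ho]; exact Or.inl rfl
  rcases hp : c.pending (σ.link t) with _ | ⟨m, rest⟩
  · rw [deliver_of_pending P ω _ c hp]; exact Or.inl rfl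
  rw [deliver_cons P ω _ c ho hp]
  by_cases hi : σ.link t = i
  · subst hi
    exact Or.inr ⟨rfl, m, by simp⟩
  · left
    simp [Function.update_of_ne (Ne.symm hi)]

theorem received_mono {n : ℕ} (P : Protocol n) (σ : Schedule n) (ω : V n → RandomString n)
    {t t' : ℕ} (h : t ≤ t') (i : V n) :
    (run P σ ω t).received i <+: (run P σ ω t').received i := by
  induction h with
  | refl => exact List.prefix_rfl
  | step _ ih =>
    refine ih.trans ?_
    rcases received_succ P σ ω _ i with h | ⟨-, m, h⟩
    · rw [h]
    · rw [h]; exact List.prefix_append _ _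

theorem output_stable {n : ℕ} (P : Protocol n) (σ : Schedule n) (ω : V n → RandomString n)
    {t t' : ℕ} (h : t ≤ t') (i : V n) {x : Option (V n)}
    (hx : (run P σ ω t).output i = some x) : (run P σ ω t').output i = some x := by
  induction h with
  | refl => exact hx
  | @step t' _ ih =>
    simp only [run]
    set c := run P σ ω t'
    by_cases ho : c.output (σ.link t') = none
    swap
    · rwa [deliver_of_output P ω _ c ho]
    rcases hp : c.pending (σ.link t') with _ | ⟨m, rest⟩
    · rwa [deliver_of_pending P ω _ c hp]
    rw [deliver_cons P ω _ c ho hp]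
    have hi : i ≠ σ.link t' := by
      rintro rfl
      rw [ih] at ho
      cases ho
    simpa [Function.update_of_ne hi] using ih

theorem received_prefix_transduce {n : ℕ} (P : Protocol n) (σ : Schedule n)
    (ω : V n → RandomString n) (t : ℕ) (i : V n) :
    (run P σ ω t).received (i + 1) <+: transduce P ω i ((run P σ ω t).received i) := by
  rw [← (run_reachable P σ ω t).sent i]
  exact List.prefix_append _ _

theorem received_prefix_relay {n : ℕ} (P : Protocol n) (σ : Schedule n)
    (ω : V n → RandomString n) (t : ℕ) (a : V n) {w : List ℕ}
    (hw : (run P σ ω t).received a <+: w) (j : ℕ) :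
    (run P σ ω t).received (a + j) <+: relay P ω a w j := by
  induction j with
  | zero => simpa [relay] using hw
  | succ j ih =>
    rw [Nat.cast_succ, ← add_assoc]
    exact (received_prefix_transduce P σ ω t (a + j)).trans (transduce_prefix P ω _ ih)

/-- If all processors output `o`, then they have all done so at some common time. -/
theorem AllOutput.exists_time {n : ℕ} [NeZero n] {P : Protocol n} {σ : Schedule n}
    {ω : V n → RandomString n} {o : V n} (h : AllOutput P σ ω o) :
    ∃ T, ∀ t, T ≤ t → ∀ i, (run P σ ω t).output i = some (some o) := by
  choose t ht using h
  refine ⟨Finset.univ.sup t, fun s hs i => ?_⟩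
  exact output_stable P σ ω ((Finset.le_sup (Finset.mem_univ i)).trans hs) i (ht i)

/-! ### The stream function of an honest processor -/

/-- The residues of the messages in a list. -/
def residues (n : ℕ) (w : List ℕ) : List (V n) := w.map (Nat.cast : ℕ → V n)

@[simp] theorem length_residues (n : ℕ) (w : List ℕ) : (residues n w).length = w.length := by
  simp [residues]

theorem residues_append (n : ℕ) (w w' : List ℕ) :
    residues n (w ++ w') = residues n w ++ residues n w' := by
  simp [residues]

@[simp] theorem residues_map_val (n : ℕ) [NeZero n] (l : List (V n)) :
    residues n (l.map ZMod.val) = l := by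
  rw [residues, List.map_map]
  conv_rhs => rw [← List.map_id l]
  congr 1
  ext x
  simp

theorem aLeadAct_eq (n : ℕ) (i d : V n) (h : List ℕ) : aLeadAct n i d h =
    { send :=
        if i = origin n then
          if h.length < n then [((residues n h).getLastD d).val] else []
        else
          if h = [] then [] else [((residues n h).dropLast.getLastD d).val]
      output :=
        if h.length = n then
          if (residues n h).getLast? = some d then some (some (residues n h).sum) else some none
        else none } := by
  have : (List.map (fun m => m) (h >>= fun a => pure (a : V n)) : List (V n)) = residues n h := by
    induction h with
    | nil => rfl
    | cons a h ih => simp_all [residues]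
  simp only [aLeadAct, this]

/-- The number of messages that an honest processor has sent after the receipt of `r ≤ n`
messages. -/
def sentCount (n : ℕ) (i : V n) (r : ℕ) : ℕ := if i = origin n then min (r + 1) n else r

theorem aLeadAct_output_of_lt {n : ℕ} (i d : V n) {w : List ℕ} (h : w.length < n) :
    (aLeadAct n i d w).output = none := by
  simp [aLeadAct_eq, h.ne]

/-- An honest processor sends its secret, followed by what it receives. -/
theorem emitFrom_aLeadAct {n : ℕ} [NeZero n] (i d : V n) (w : List ℕ) (hw : w.length ≤ n) :
    emitFrom (aLeadAct n i d) [] w =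
      ((d :: residues n w).take (sentCount n i w.length)).map ZMod.val := by
  induction w using List.reverseRecOn with
  | nil =>
    have hn : 0 < n := Nat.pos_of_ne_zero (NeZero.ne n)
    by_cases hi : i = origin n <;>
      simp [emitFrom, aLeadAct_eq, sentCount, hi, residues, hn]
    exact hn
  | append_singleton w m ih =>
    rw [List.length_append, List.length_singleton] at hw
    rw [emitFrom_concat, ih (by omega)]
    swap
    · intro v hv
      exact aLeadAct_output_of_lt i d (by have := hv.length_le; simp; omega)
    by_cases hi : i = origin n
    · simp only [sentCount, hi, if_true, aLeadAct_eq, List.nil_append, List.length_append,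
        List.length_singleton]
      by_cases hlt : w.length + 1 < n
      · rw [if_pos hlt, Nat.min_eq_left hw, Nat.min_eq_left (by omega : w.length + 1 + 1 ≤ n),
          residues_append, List.take_of_length_le (by simp), List.take_of_length_le (by simp)]
        simp [residues]
      · rw [if_neg hlt, Nat.min_eq_right (by omega), Nat.min_eq_right (by omega), residues_append,
          List.append_nil, ← List.cons_append, List.take_append_of_le_length (by simp; omega)]
    · simp only [sentCount, hi, if_false, aLeadAct_eq, List.nil_append, List.length_append,
        List.length_singleton]
      rw [if_neg (by simp), residues_append, ← List.cons_append,
        List.take_append_of_le_length (by simp), List.take_of_length_le (l := d :: residues n w)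
          (i := w.length + 1) (by simp)]
      have : d :: residues n w = (d :: residues n w).take w.length ++
          [(residues n w).getLastD d] := by
        generalize hl : residues n w = l
        have hlen : w.length = l.length := by simp [← hl]
        rw [hlen]
        induction l using List.reverseRecOn with
        | nil => simp
        | append_singleton l x => simp
      conv_rhs => rw [this]
      simp [residues]

/-! ### Honest processors in a run -/

section Honest

variable {n : ℕ} {C : Finset (V n)} {D : Protocol n}

theorem sentCount_le (i : V n) (r : ℕ) :
    sentCount n i r ≤ r + if i = origin n then 1 else 0 := by
  unfold sentCount
  split_ifs <;> omega

theorem act_of_notMem (hD : IsDeviation (aLeadUni n) C D) (ω : V n → RandomString n) {i : V n}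
    (hi : i ∉ C) : (D i).act i (ω i) = aLeadAct n i (ω i 0) := by
  rw [hD i hi]
  rfl

theorem length_received_le (hD : IsDeviation (aLeadUni n) C D) (σ : Schedule n)
    (ω : V n → RandomString n) (t : ℕ) {i : V n} (hi : i ∉ C) :
    ((run D σ ω t).received i).length ≤ n := by
  by_contra! h
  have := (run_reachable D σ ω t).live i (((run D σ ω t).received i).take n)
    (List.take_prefix _ _) (fun h' => by
      have := congrArg List.length h'
      rw [List.length_take] at this
      omega)
  rw [act_of_notMem hD ω hi, aLeadAct_eq, List.length_take, Nat.min_eq_left h.le] at this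
  simp only [if_true] at this
  split_ifs at this

/-- An honest processor that outputs a valid `o` has received `n` messages, which sum up to `o`, and
the last of them is its own secret. -/
theorem received_of_output (hD : IsDeviation (aLeadUni n) C D) (σ : Schedule n)
    (ω : V n → RandomString n) (t : ℕ) {i : V n} (hi : i ∉ C) {o : V n}
    (ho : (run D σ ω t).output i = some (some o)) :
    ((run D σ ω t).received i).length = n ∧
      (residues n ((run D σ ω t).received i)).getLast? = some (ω i 0) ∧
      (residues n ((run D σ ω t).received i)).sum = o := by
  rw [(run_reachable D σ ω t).out i, act_of_notMem hD ω hi, aLeadAct_eq] at ho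
  simp only at ho
  split_ifs at ho with h1 h2
  · exact ⟨h1, h2, by simpa using ho⟩
  · simp at ho

variable [NeZero n]

theorem transduce_of_notMem (hD : IsDeviation (aLeadUni n) C D) (ω : V n → RandomString n)
    {i : V n} (hi : i ∉ C) {w : List ℕ} (hw : w.length ≤ n) :
    transduce D ω i w =
      ((ω i 0 :: residues n w).take (sentCount n i w.length)).map ZMod.val := by
  rw [transduce, act_of_notMem hD ω hi, emitFrom_aLeadAct _ _ _ hw]

/-- What the successor of an honest processor `i` receives is a prefix of the secret of `i` followed
by what `i` receives. -/
theorem received_prefix_of_notMem (hD : IsDeviation (aLeadUni n) C D) (σ : Schedule n)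
    (ω : V n → RandomString n) (t : ℕ) {i : V n} (hi : i ∉ C) :
    (run D σ ω t).received (i + 1) <+:
      (ω i 0 :: residues n ((run D σ ω t).received i)).map ZMod.val := by
  refine (received_prefix_transduce D σ ω t i).trans ?_
  rw [transduce_of_notMem hD ω hi (length_received_le hD σ ω t hi)]
  exact (List.take_prefix _ _).map _

theorem length_received_succ_le (hD : IsDeviation (aLeadUni n) C D) (σ : Schedule n)
    (ω : V n → RandomString n) (t : ℕ) {i : V n} (hi : i ∉ C) :
    ((run D σ ω t).received (i + 1)).length ≤
      ((run D σ ω t).received i).length + if i = origin n then 1 else 0 := by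
  have h := (received_prefix_transduce D σ ω t i).length_le
  rw [transduce_of_notMem hD ω hi (length_received_le hD σ ω t hi), List.length_map,
    List.length_take] at h
  exact h.trans ((min_le_left _ _).trans (sentCount_le i _))

end Honest

section Coalition

variable {n : ℕ} [NeZero n] {C : Finset (V n)} {D : Protocol n} {σ : Schedule n}
  {ω ω' : V n → RandomString n}

/-! ### Successful runs are determined by what one honest processor receives -/

omit [NeZero n] in
theorem transduce_congr (P : Protocol n) {i : V n} (h : ω i = ω' i) (w : List ℕ) :
    transduce P ω i w = transduce P ω' i w := by
  rw [transduce, transduce, h]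

omit [NeZero n] in
theorem transduce_congr_of_notMem (hD : IsDeviation (aLeadUni n) C D) {i : V n} (hi : i ∉ C)
    (h : ω i 0 = ω' i 0) (w : List ℕ) : transduce D ω i w = transduce D ω' i w := by
  rw [transduce, transduce, act_of_notMem hD ω hi, act_of_notMem hD ω' hi, h]

omit [NeZero n] in
theorem relay_congr (P : Protocol n) (a : V n) (w : List ℕ) (j : ℕ)
    (h : ∀ i < j, ω (a + (i : ℕ)) = ω' (a + (i : ℕ))) : relay P ω a w j = relay P ω' a w j := by
  induction j with
  | zero => rfl
  | succ j ih =>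
    rw [relay, relay, ih fun i hi => h i (by omega), transduce_congr P (h j (by omega))]

theorem exists_eq_add_natCast (a i : V n) : ∃ j < n, i = a + (j : ℕ) :=
  ⟨(i - a).val, ZMod.val_lt _, by rw [ZMod.natCast_zmod_val]; ring⟩

theorem eq_of_prefix_of_length_eq {α : Type*} {l₁ l₂ l : List α} (h₁ : l₁ <+: l) (h₂ : l₂ <+: l)
    (h : l₁.length = l₂.length) : l₁ = l₂ := by
  rw [List.prefix_iff_eq_take.1 h₁, List.prefix_iff_eq_take.1 h₂, h]

theorem take_eq_take_of_prefix {α : Type*} {l₁ l : List α} (h : l₁ <+: l) {m : ℕ}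
    (hm : m ≤ l₁.length) : l₁.take m = l.take m := by
  obtain ⟨v, rfl⟩ := h
  rw [List.take_append_of_le_length hm]

/-- At time `T` all processors have terminated with output `o`. -/
def OutputsAt (P : Protocol n) (σ : Schedule n) (ω : V n → RandomString n) (o : V n) (T : ℕ) :
    Prop :=
  ∀ i, (run P σ ω T).output i = some (some o)

/-- A successful run is determined by the strings of the coalition and by the residues which a
single honest processor `p` receives: these end with the secret of `p`, so they determine all that
`p` sends, hence all that its successor receives, and so on around the ring. -/
theorem secret_eq_of_residues_eq (hD : IsDeviation (aLeadUni n) C D)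
    (hC : ∀ i ∈ C, ω i = ω' i) {o o' : V n} {T T' : ℕ} (h : OutputsAt D σ ω o T)
    (h' : OutputsAt D σ ω' o' T') {p : V n} (hp : p ∉ C)
    (hX : residues n ((run D σ ω T).received p) = residues n ((run D σ ω' T').received p))
    {i : V n} (hi : i ∉ C) : ω i 0 = ω' i 0 := by
  have key : ∀ q ∉ C, residues n ((run D σ ω T).received q) =
      residues n ((run D σ ω' T').received q) → ω q 0 = ω' q 0 := by
    intro q hq hX
    have h1 := (received_of_output hD σ ω T hq (h q)).2.1
    have h2 := (received_of_output hD σ ω' T' hq (h' q)).2.1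
    rw [hX, h2] at h1
    exact (Option.some.inj h1).symm
  have hfirst : transduce D ω p ((run D σ ω T).received p) =
      transduce D ω' p ((run D σ ω' T').received p) := by
    rw [transduce_of_notMem hD ω hp (length_received_le hD σ ω T hp),
      transduce_of_notMem hD ω' hp (length_received_le hD σ ω' T' hp), key p hp hX, hX,
      (received_of_output hD σ ω T hp (h p)).1, (received_of_output hD σ ω' T' hp (h' p)).1]
  have hsecret : ∀ j : ℕ, p + 1 + (j : ℕ) ∉ C →
      relay D ω (p + 1) (transduce D ω p ((run D σ ω T).received p)) j =
      relay D ω' (p + 1) (transduce D ω' p ((run D σ ω' T').received p)) j →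
      ω (p + 1 + (j : ℕ)) 0 = ω' (p + 1 + (j : ℕ)) 0 := by
    intro j hj hr
    refine key _ hj ?_
    have h1 := received_prefix_relay D σ ω T (p + 1) (received_prefix_transduce D σ ω T p) j
    have h2 := received_prefix_relay D σ ω' T' (p + 1) (received_prefix_transduce D σ ω' T' p) j
    rw [← hr] at h2
    rw [eq_of_prefix_of_length_eq h1 h2]
    rw [(received_of_output hD σ ω T hj (h _)).1, (received_of_output hD σ ω' T' hj (h' _)).1]
  have hrelay : ∀ j : ℕ, relay D ω (p + 1) (transduce D ω p ((run D σ ω T).received p)) j =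
      relay D ω' (p + 1) (transduce D ω' p ((run D σ ω' T').received p)) j := by
    intro j
    induction j with
    | zero => exact hfirst
    | succ j ih =>
      rw [relay, relay, ih]
      by_cases hj : p + 1 + (j : ℕ) ∈ C
      · exact transduce_congr D (hC _ hj) _
      · exact transduce_congr_of_notMem hD hj (hsecret j hj ih) _
  obtain ⟨j, -, rfl⟩ := exists_eq_add_natCast (p + 1) i
  exact hsecret j hi (hrelay j)

/-! ### Rushing -/

/-- The honest processors `q` and `q + 1 + l` are separated by exactly `l` members of the
coalition. Honest neighbours are the case `l = 0`. -/
structure IsGap (C : Finset (V n)) (q : V n) (l : ℕ) : Prop where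
  left : q ∉ C
  mem : ∀ i < l, q + 1 + (i : ℕ) ∈ C
  right : q + 1 + (l : ℕ) ∉ C

/-- The run succeeds although, at some time, the `l` processors after `q` had delivered more than
`r + g` messages to the next honest processor when they had only received `r`. -/
def Rushes (D : Protocol n) (σ : Schedule n) (g : ℕ) (q : V n) (l r : ℕ)
    (ω : V n → RandomString n) : Prop :=
  (∃ o, AllOutput D σ ω o) ∧ ∃ t, ((run D σ ω t).received (q + 1)).length = r ∧
    r + g + 1 ≤ ((run D σ ω t).received (q + 1 + (l : ℕ))).length

theorem received_eq_map_residues (hD : IsDeviation (aLeadUni n) C D) (t : ℕ) {i : V n}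
    (hi : i ∉ C) : (run D σ ω t).received (i + 1) =
      (residues n ((run D σ ω t).received (i + 1))).map ZMod.val := by
  have h := List.prefix_iff_eq_take.1 (received_prefix_of_notMem hD σ ω t hi)
  rw [← List.map_take] at h
  rw [h, residues_map_val]

/-- Two runs in which a gap rushes have the same secrets if the gap has received the same `r`
messages and the part of the input of the next honest processor beyond its first `r + g + 1` symbols
is the same: the first `r + g + 1` symbols are a function of the `r` messages. -/
theorem secret_eq_of_rush (hD : IsDeviation (aLeadUni n) C D)
    (hC : ∀ i ∈ C, ω i = ω' i) {o o' : V n} {T T' : ℕ} (h : OutputsAt D σ ω o T)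
    (h' : OutputsAt D σ ω' o' T') {q : V n} {l m t t' : ℕ} (hq : IsGap C q l) (ht : t ≤ T)
    (ht' : t' ≤ T') (hm : m ≤ ((run D σ ω t).received (q + 1 + (l : ℕ))).length)
    (hm' : m ≤ ((run D σ ω' t').received (q + 1 + (l : ℕ))).length)
    (hin : residues n ((run D σ ω t).received (q + 1)) =
      residues n ((run D σ ω' t').received (q + 1)))
    (hout : (residues n ((run D σ ω T).received (q + 1 + (l : ℕ)))).drop m =
      (residues n ((run D σ ω' T').received (q + 1 + (l : ℕ)))).drop m)
    {i : V n} (hi : i ∉ C) : ω i 0 = ω' i 0 := by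
  refine secret_eq_of_residues_eq hD hC h h' hq.right ?_ hi
  have hin' : (run D σ ω t).received (q + 1) = (run D σ ω' t').received (q + 1) := by
    rw [received_eq_map_residues hD t hq.left, hin, ← received_eq_map_residues hD t' hq.left]
  have h1 := received_prefix_relay D σ ω t (q + 1) List.prefix_rfl l
  have h2 := received_prefix_relay D σ ω' t' (q + 1) List.prefix_rfl l
  rw [hin', relay_congr D (q + 1) _ l fun i hi => hC _ (hq.mem i hi)] at h1
  have htake : ((run D σ ω T).received (q + 1 + (l : ℕ))).take m =
      ((run D σ ω' T').received (q + 1 + (l : ℕ))).take m := by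
    rw [← take_eq_take_of_prefix (received_mono D σ ω ht _) hm,
      ← take_eq_take_of_prefix (received_mono D σ ω' ht' _) hm',
      take_eq_take_of_prefix h1 hm, take_eq_take_of_prefix h2 hm']
  rw [← List.take_append_drop m (residues n ((run D σ ω T).received (q + 1 + (l : ℕ)))), hout,
    ← List.take_append_drop m (residues n ((run D σ ω' T').received (q + 1 + (l : ℕ))))]
  congr 1
  · simp only [residues, ← List.map_take, htake]
  · simp [residues]

/-! ### Without rushing, all honest processors are synchronized -/

/-- The number of members of `S` among `a, …, a + j - 1`. -/
def countFrom (S : Finset (V n)) (a : V n) (j : ℕ) : ℕ :=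
  ((Finset.range j).filter fun i => a + ((i : ℕ) : V n) ∈ S).card

omit [NeZero n] in
theorem countFrom_le_card (S : Finset (V n)) (a : V n) {j : ℕ} (hj : j ≤ n) :
    countFrom S a j ≤ S.card := by
  refine Finset.card_le_card_of_injOn (fun i : ℕ => a + (i : V n)) ?_ ?_
  · intro i hi
    exact (Finset.mem_filter.1 hi).2
  · intro i hi i' hi' h
    have h1 := Finset.mem_range.1 (Finset.mem_filter.1 hi).1
    have h2 := Finset.mem_range.1 (Finset.mem_filter.1 hi').1
    have := congrArg ZMod.val (add_left_cancel h)
    rwa [ZMod.val_natCast_of_lt (by omega), ZMod.val_natCast_of_lt (by omega)] at this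

omit [NeZero n] in
theorem countFrom_succ (S : Finset (V n)) (a : V n) (j : ℕ) :
    countFrom S a (j + 1) = countFrom S a j + if a + (j : V n) ∈ S then 1 else 0 := by
  unfold countFrom
  rw [Finset.range_add_one, Finset.filter_insert]
  split_ifs
  · rw [Finset.card_insert_of_notMem (by simp)]
  · rfl

omit [NeZero n] in
theorem countFrom_mono (S : Finset (V n)) (a : V n) {j j' : ℕ} (h : j ≤ j') :
    countFrom S a j ≤ countFrom S a j' := by
  induction h with
  | refl => exact le_rfl
  | step _ ih => rw [countFrom_succ]; omega

omit [NeZero n] in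
theorem IsGap.countFrom_eq {a : V n} {j l : ℕ} (h : IsGap C (a + (j : V n)) l) :
    countFrom C a (j + 1 + l) = countFrom C a j + l := by
  have : ∀ l' ≤ l, countFrom C a (j + 1 + l') = countFrom C a j + l' := by
    intro l' hl'
    induction l' with
    | zero => simp [countFrom_succ, h.left]
    | succ l' ih =>
      have hm : a + ((j + 1 + l' : ℕ) : V n) ∈ C := by
        have := h.mem l' (by omega)
        push_cast
        simpa [add_assoc] using this
      rw [← add_assoc, countFrom_succ, ih (by omega), if_pos hm, add_assoc]
  exact this l le_rfl

omit [NeZero n] in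
/-- To prove something of all honest processors, go around the ring from an honest processor to the
next one. -/
theorem gap_induction {a : V n} (ha : a ∉ C) (Φ : ℕ → Prop) (h0 : Φ 0)
    (hstep : ∀ j l, IsGap C (a + (j : ℕ)) l → Φ j → Φ (j + 1 + l)) (j : ℕ)
    (hj : a + (j : V n) ∉ C) : Φ j := by
  have hlast : ∀ j : ℕ, ∃ m ≤ j, a + (m : V n) ∉ C ∧
      ∀ i, m < i → i < j + 1 → a + (i : V n) ∈ C := by
    intro j
    induction j with
    | zero => exact ⟨0, le_rfl, by simpa using ha, fun i _ _ => by omega⟩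
    | succ j ih =>
      by_cases hj : a + ((j + 1 : ℕ) : V n) ∈ C
      · obtain ⟨m, hm, hmC, hm'⟩ := ih
        refine ⟨m, by omega, hmC, fun i hi hi' => ?_⟩
        rcases (by omega : i < j + 1 ∨ i = j + 1) with h | rfl
        · exact hm' i hi h
        · exact hj
      · exact ⟨j + 1, le_rfl, hj, fun i _ _ => by omega⟩
  induction j using Nat.strong_induction_on with
  | _ j ih =>
    rcases j with _ | j
    · exact h0
    obtain ⟨m, hm, hmC, hm'⟩ := hlast j
    obtain ⟨l, rfl⟩ := Nat.exists_eq_add_of_le hm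
    rw [show m + l + 1 = m + 1 + l by omega] at hj ⊢
    refine hstep m l ⟨hmC, fun i hi => ?_, ?_⟩ (ih m (by omega) hmC)
    · have := hm' (m + 1 + i) (by omega) (by omega)
      push_cast at this
      simpa [add_assoc] using this
    · push_cast at hj
      simpa [add_assoc] using hj

/-- At no time does a gap rush by more than `g`. -/
def NoRush (C : Finset (V n)) (D : Protocol n) (σ : Schedule n) (g : ℕ)
    (ω : V n → RandomString n) : Prop :=
  ∀ q l t, IsGap C q l → ((run D σ ω t).received (q + 1 + (l : ℕ))).length ≤
    ((run D σ ω t).received (q + 1)).length + g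

/-- Without rushing, no honest processor is ahead of another one by more than `|C| * g + 1`
messages: from an honest processor to the next one the lead grows by at most `g`, and only if there
is a member of the coalition in between; the origin adds one. -/
theorem NoRush.length_received_le (hD : IsDeviation (aLeadUni n) C D) {g : ℕ}
    (hg : NoRush C D σ g ω) (t : ℕ) {p q : V n} (hp : p ∉ C) (hq : q ∉ C) :
    ((run D σ ω t).received p).length ≤
      ((run D σ ω t).received q).length + (g * C.card + 1) := by
  obtain ⟨j, hj, rfl⟩ := exists_eq_add_natCast q p
  have := gap_induction hq (fun j => ((run D σ ω t).received (q + (j : ℕ))).length ≤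
      ((run D σ ω t).received q).length + (g * countFrom C q j + countFrom {origin n} q j))
    (by simp) (fun j l hl ih => ?_) j hp
  · have h1 := countFrom_le_card C q hj.le
    have h2 := countFrom_le_card {origin n} q hj.le
    rw [Finset.card_singleton] at h2
    have := Nat.mul_le_mul_left g h1
    omega
  · have h1 := length_received_succ_le hD σ ω t hl.left
    have h2 := hg _ _ t hl
    have h3 := hl.countFrom_eq
    have h4 : countFrom {origin n} q j + (if q + (j : V n) = origin n then 1 else 0) ≤
        countFrom {origin n} q (j + 1 + l) := by
      have := countFrom_mono {origin n} q (show j + 1 ≤ j + 1 + l by omega)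
      rw [countFrom_succ] at this
      simpa using this
    have hcast : q + ((j + 1 + l : ℕ) : V n) = q + (j : ℕ) + 1 + (l : ℕ) := by push_cast; ring
    simp only [hcast, h3, mul_add]
    rcases Nat.eq_zero_or_pos l with rfl | hl0
    · simp at h2 ⊢
      simp at h4
      omega
    · have := Nat.le_mul_of_pos_right g hl0
      omega

end Coalition

section Delay

variable {n : ℕ} [NeZero n] {C : Finset (V n)} {D : Protocol n} {σ : Schedule n}
  {ω ω' : V n → RandomString n}

/-! ### A secret returns too late to be cancelled -/

/-- In a run without rushing, a gap has delivered `N` messages to the next honest processor by the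
time when it has received `B` messages, if `N` is less than `B` by the lead that is possible between
honest processors. -/
theorem NoRush.exists_time (hD : IsDeviation (aLeadUni n) C D) {g : ℕ} (hg : NoRush C D σ g ω)
    {o : V n} {T : ℕ} (h : OutputsAt D σ ω o T) {q : V n} {l B N : ℕ} (hq : IsGap C q l)
    (hl : 0 < l) (hN : N ≤ n) (hB : N + (g * C.card + 1) ≤ B) :
    ∃ t ≤ T, ((run D σ ω t).received (q + 1)).length ≤ B ∧
      N ≤ ((run D σ ω t).received (q + 1 + (l : ℕ))).length := by
  by_cases hT : ((run D σ ω T).received (q + 1)).length ≤ B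
  · exact ⟨T, le_rfl, hT, by rwa [(received_of_output hD σ ω T hq.right (h _)).1]⟩
  -- `t` is the last time at which the gap has received at most `B` messages.
  have hex : ∃ t, B < ((run D σ ω t).received (q + 1)).length := ⟨T, not_le.1 hT⟩
  classical
  have hspec := Nat.find_spec hex
  have hmin := fun t => Nat.find_min (H := hex) (m := t)
  have hle := Nat.find_min' hex (not_le.1 hT)
  rcases hf : Nat.find hex with _ | t
  · rw [hf] at hspec
    simp [run, Config.initial] at hspec
  rw [hf] at hspec hle
  have ht := not_lt.1 (hmin t (by omega))
  refine ⟨t, by omega, ht, ?_⟩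
  rcases received_succ D σ ω t (q + 1) with h1 | ⟨hlink, -⟩
  · rw [h1] at hspec; omega
  have hne : q + 1 + (l : V n) ≠ q + 1 := by
    intro h
    have h0 := hq.mem 0 hl
    rw [Nat.cast_zero, add_zero] at h0
    exact hq.right (by rwa [h])
  have hsame : (run D σ ω (t + 1)).received (q + 1 + (l : ℕ)) =
      (run D σ ω t).received (q + 1 + (l : ℕ)) := by
    rcases received_succ D σ ω t (q + 1 + (l : ℕ)) with h1 | ⟨h1, -⟩
    · exact h1
    · exact absurd (h1.symm.trans hlink) hne
  rw [← hsame]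
  have h1 := length_received_succ_le hD σ ω (t + 1) hq.left
  have h2 := hg.length_received_le hD (t + 1) hq.left hq.right
  split_ifs at h1 <;> omega

theorem received_succ_of_outputsAt (hD : IsDeviation (aLeadUni n) C D) {o : V n} {T : ℕ}
    (h : OutputsAt D σ ω o T) {i : V n} (hi : i ∉ C) (hi' : i + 1 ∉ C) :
    (run D σ ω T).received (i + 1) =
      ((ω i 0 :: residues n ((run D σ ω T).received i)).map ZMod.val).take n := by
  have h1 := List.prefix_iff_eq_take.1 (received_prefix_of_notMem hD σ ω T hi)
  rwa [(received_of_output hD σ ω T hi' (h _)).1] at h1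

omit [NeZero n] in
theorem residues_take {m : ℕ} {w w' : List ℕ} (h : w.take m = w'.take m) :
    (residues n w).take m = (residues n w').take m := by
  simp only [residues, ← List.map_take, h]

/-- Two successful runs without rushing whose random strings differ at the honest processor `s` only
differ little: what the `j`-th processor after `s + 1` receives is the same up to about position
`j`, less a loss that is proportional to the number of members of the coalition on the way. -/
theorem NoRush.take_received_eq (hD : IsDeviation (aLeadUni n) C D) {g : ℕ}
    (hg : NoRush C D σ g ω) (hg' : NoRush C D σ g ω') {o o' : V n} {T T' : ℕ}
    (h : OutputsAt D σ ω o T) (h' : OutputsAt D σ ω' o' T') {s : V n} (hs : s ∉ C)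
    (hs' : s + 1 ∉ C) (hω : ∀ i, i ≠ s → ω i = ω' i) (j : ℕ) (hj : s + 1 + (j : V n) ∉ C) :
    j < n → ∀ N, N + (g * C.card + 2) * countFrom C (s + 1) j ≤ j →
      ((run D σ ω T).received (s + 1 + (j : ℕ))).take N =
        ((run D σ ω' T').received (s + 1 + (j : ℕ))).take N := by
  have hC : ∀ i ∈ C, ω i = ω' i := fun i hi => hω i (by rintro rfl; exact hs hi)
  refine gap_induction hs' (fun j => j < n → ∀ N,
    N + (g * C.card + 2) * countFrom C (s + 1) j ≤ j →
      ((run D σ ω T).received (s + 1 + (j : ℕ))).take N =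
        ((run D σ ω' T').received (s + 1 + (j : ℕ))).take N) ?_ ?_ j hj
  · intro _ N hN
    obtain rfl : N = 0 := by omega
    simp
  intro j l hl ih hjn N hN
  have hcast : s + 1 + ((j + 1 + l : ℕ) : V n) = s + 1 + (j : ℕ) + 1 + (l : ℕ) := by
    push_cast; ring
  rw [hcast]
  rw [hl.countFrom_eq] at hN
  have hne : s + 1 + (j : V n) ≠ s := by
    intro h
    have h1 : ((1 + j : ℕ) : V n) = 0 := by
      push_cast
      have : s + (1 + (j : V n)) = s + 0 := by rw [← add_assoc, h, add_zero]
      exact add_left_cancel this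
    rw [ZMod.natCast_eq_zero_iff] at h1
    have := Nat.le_of_dvd (by omega) h1
    omega
  have hd : ω (s + 1 + (j : ℕ)) 0 = ω' (s + 1 + (j : ℕ)) 0 := by rw [hω _ hne]
  generalize s + 1 + (j : V n) = q at hl ih hd
  rcases Nat.eq_zero_or_pos N with rfl | hN0
  · simp
  have hstep : ∀ B, 0 < B → B + (g * C.card + 2) * countFrom C (s + 1) j ≤ j + 1 →
      ((ω q 0 :: residues n ((run D σ ω T).received q)).map ZMod.val).take B =
      ((ω' q 0 :: residues n ((run D σ ω' T').received q)).map ZMod.val).take B := by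
    intro B hB hBj
    obtain ⟨B, rfl⟩ := Nat.exists_eq_succ_of_ne_zero hB.ne'
    rw [← List.map_take, ← List.map_take, List.take_succ_cons, List.take_succ_cons, hd,
      residues_take (ih (by omega) B (by omega))]
  rcases Nat.eq_zero_or_pos l with rfl | hl0
  · have hr := hl.right
    simp only [Nat.cast_zero, add_zero] at hr hN ⊢
    rw [received_succ_of_outputsAt hD h hl.left hr, received_succ_of_outputsAt hD h' hl.left hr,
      List.take_take, List.take_take, Nat.min_eq_left (by omega), hstep N hN0 hN]
  · set G := g * C.card + 1 with hG
    have hGl : G ≤ G * l := Nat.le_mul_of_pos_right G hl0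
    have hexp : (g * C.card + 2) * (countFrom C (s + 1) j + l) =
        (g * C.card + 2) * countFrom C (s + 1) j + (G * l + l) := by rw [hG]; ring
    rw [hexp] at hN
    have hB := hstep (N + G) (by omega) (by omega)
    -- The next honest processor gets its first `N` messages while the gap has received at most
    -- `N + G`, so they are a function of the first `N + G` messages that the gap is offered.
    have hprefix : ∀ {ω : V n → RandomString n} {o : V n} {T : ℕ}, NoRush C D σ g ω →
        OutputsAt D σ ω o T → ((run D σ ω T).received (q + 1 + (l : ℕ))).take N =
          (relay D ω (q + 1) (((ω q 0 :: residues n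
            ((run D σ ω T).received q)).map ZMod.val).take (N + G)) l).take N := by
      intro ω o T hg h
      obtain ⟨t, htT, ht, htN⟩ := hg.exists_time hD h hl hl0 (by omega : N ≤ n) le_rfl
      rw [← take_eq_take_of_prefix (received_mono D σ ω htT _) htN]
      refine take_eq_take_of_prefix (received_prefix_relay D σ ω t (q + 1) ?_ l) htN
      refine List.prefix_take_iff.2 ⟨?_, ht⟩
      exact (received_mono D σ ω htT _).trans (received_prefix_of_notMem hD σ ω T hl.left)
    rw [hprefix hg h, hprefix hg' h', hB,
      relay_congr D (q + 1) _ l fun i hi => hC _ (hl.mem i hi)]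

/-- The processors after `s` on an honest segment receive the secrets of the segment, beginning
with the secret of `s` at the end, and then what `s` receives. -/
theorem exists_residues_segment (hD : IsDeviation (aLeadUni n) C D) {o o' : V n} {T T' : ℕ}
    (h : OutputsAt D σ ω o T) (h' : OutputsAt D σ ω' o' T') {s : V n}
    (hω : ∀ i, i ≠ s → ω i = ω' i) (j : ℕ) (hjn : j + 1 < n)
    (hs : ∀ i < j + 2, s + (i : V n) ∉ C) :
    ∃ L : List (V n), L.length = j ∧
      residues n ((run D σ ω T).received (s + (j : ℕ) + 1)) =
        (L ++ ω s 0 :: residues n ((run D σ ω T).received s)).take n ∧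
      residues n ((run D σ ω' T').received (s + (j : ℕ) + 1)) =
        (L ++ ω' s 0 :: residues n ((run D σ ω' T').received s)).take n := by
  have hrec : ∀ {ω : V n → RandomString n} {o : V n} {T : ℕ} (i : V n), i ∉ C → i + 1 ∉ C →
      OutputsAt D σ ω o T → residues n ((run D σ ω T).received (i + 1)) =
        (ω i 0 :: residues n ((run D σ ω T).received i)).take n := by
    intro ω o T i hi hi' h
    rw [received_succ_of_outputsAt hD h hi hi', ← List.map_take, residues_map_val]
  induction j with
  | zero =>
    have h0 := hs 0 (by omega)
    have h1 := hs 1 (by omega)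
    simp only [Nat.cast_zero, add_zero, Nat.cast_one] at h0 h1 ⊢
    exact ⟨[], rfl, hrec s h0 h1 h, hrec s h0 h1 h'⟩
  | succ j ih =>
    obtain ⟨L, hL, h1, h2⟩ := ih (by omega) fun i hi => hs i (by omega)
    have hne : s + ((j + 1 : ℕ) : V n) ≠ s := by
      intro h
      have h1 : ((j + 1 : ℕ) : V n) = 0 := by simpa using h
      rw [ZMod.natCast_eq_zero_iff] at h1
      have := Nat.le_of_dvd (by omega) h1
      omega
    have hm := hs (j + 1) (by omega)
    have hm' := hs (j + 2) (by omega)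
    have hcast : s + ((j + 2 : ℕ) : V n) = s + ((j + 1 : ℕ) : V n) + 1 := by push_cast; ring
    have hcast' : s + (j : V n) + 1 = s + ((j + 1 : ℕ) : V n) := by push_cast; ring
    rw [hcast] at hm'
    rw [hcast'] at h1 h2
    have htake : ∀ (m : ℕ) (d : V n) (Z : List (V n)),
        (d :: Z.take m).take m = (d :: Z).take m := by
      intro m d Z
      cases m with
      | zero => rfl
      | succ m =>
        rw [List.take_succ_cons, List.take_succ_cons, List.take_take, Nat.min_eq_left (by omega)]
    refine ⟨ω (s + ((j + 1 : ℕ) : V n)) 0 :: L, by simp [hL], ?_, ?_⟩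
    · rw [hrec _ hm hm' h, h1, htake, List.cons_append]
    · rw [hrec _ hm hm' h', h2, htake, List.cons_append, hω _ hne]

/-- The secret of the first processor `s` of a long honest segment shifts the outcome: two
successful runs without rushing which have the same outcome and differ only in the string of `s`
have the same secret at `s`. Indeed the segment ends with the sum of its secrets and of the first
`n - L + 1` messages that `s` receives, and these messages do not depend on the secret of `s`. -/
theorem NoRush.secret_eq (hD : IsDeviation (aLeadUni n) C D) {g : ℕ}
    (hg : NoRush C D σ g ω) (hg' : NoRush C D σ g ω') {o : V n} {T T' : ℕ}
    (h : OutputsAt D σ ω o T) (h' : OutputsAt D σ ω' o T') {s : V n} {L : ℕ}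
    (hs : ∀ i < L, s + (i : V n) ∉ C) (hLn : L ≤ n)
    (hL : (g * C.card + 2) * C.card + 2 ≤ L)
    (hω : ∀ i, i ≠ s → ω i = ω' i) : ω s 0 = ω' s 0 := by
  obtain ⟨j, rfl⟩ := Nat.exists_eq_add_of_le (show 2 ≤ L by omega)
  have hs0 : s ∉ C := by simpa using hs 0 (by omega)
  have hs1 : s + 1 ∉ C := by simpa using hs 1 (by omega)
  obtain ⟨l, hl, h1, h2⟩ := exists_residues_segment hD h h' hω j (by omega)
    fun i hi => hs i (by omega)
  have hback : s + 1 + ((n - 1 : ℕ) : V n) = s := by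
    rw [Nat.cast_sub (by omega), ZMod.natCast_self]
    simp
  have hagree := hg.take_received_eq hD hg' h h' hs0 hs1 hω (n - 1) (by rwa [hback]) (by omega)
    (n - (j + 1)) (by
      have := Nat.mul_le_mul_left (g * C.card + 2)
        (countFrom_le_card C (s + 1) (show n - 1 ≤ n by omega))
      omega)
  rw [hback] at hagree
  have hend : s + (j : V n) + 1 ∉ C := by
    have := hs (j + 1) (by omega)
    push_cast at this
    rwa [← add_assoc] at this
  have hsum := (received_of_output hD σ ω T hend (h _)).2.2
  have hsum' := (received_of_output hD σ ω' T' hend (h' _)).2.2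
  have htake : ∀ (d : V n) (X : List (V n)),
      (l ++ d :: X).take n = l ++ d :: X.take (n - (j + 1)) := by
    intro d X
    rw [List.take_append, List.take_of_length_le (by omega), hl,
      show n - j = n - (j + 1) + 1 by omega, List.take_succ_cons]
  rw [h1, htake, residues_take hagree] at hsum
  rw [h2, htake, ← hsum] at hsum'
  simpa using hsum'.symm

/-- A ring with few members of the coalition has a long honest segment. -/
theorem exists_segment (C : Finset (V n)) {L : ℕ} (hL : C.card * L < n) :
    ∃ s : V n, ∀ i < L, s + (i : V n) ∉ C := by
  by_contra! hcon
  have hsub : (Finset.univ : Finset (V n)) ⊆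
      C.biUnion fun a => (Finset.range L).image fun i : ℕ => a - (i : V n) := by
    intro s _
    obtain ⟨i, hi, hiC⟩ := hcon s
    exact Finset.mem_biUnion.2 ⟨_, hiC, Finset.mem_image.2 ⟨i, Finset.mem_range.2 hi, by ring⟩⟩
  have h1 := (Finset.card_le_card hsub).trans
    (Finset.card_biUnion_le_card_mul _ _ L fun a _ => by
      simpa using Finset.card_image_le (s := Finset.range L) (f := fun i : ℕ => a - (i : V n)))
  rw [Finset.card_univ, ZMod.card] at h1
  omega

end Delay

section HonestRun

variable {n : ℕ} [NeZero n] {σ : Schedule n} {ω : V n → RandomString n}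

/-! ### The outcome of an execution -/

omit [NeZero n] in
theorem isDeviation_self (P : Protocol n) (C : Finset (V n)) : IsDeviation P C P := fun _ _ => rfl

omit [NeZero n] in
theorem AllOutput.unique {P : Protocol n} {o o' : V n} (h : AllOutput P σ ω o)
    (h' : AllOutput P σ ω o') : o = o' := by
  obtain ⟨t, ht⟩ := h 0
  obtain ⟨t', ht'⟩ := h' 0
  have h1 := output_stable P σ ω (le_max_left t t') 0 ht
  rw [output_stable P σ ω (le_max_right t t') 0 ht'] at h1
  simpa using h1.symm

theorem outcome_eq_some_iff {P : Protocol n} {o : V n} :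
    outcome P σ ω = some o ↔ AllOutput P σ ω o := by
  unfold outcome
  constructor
  · intro h
    split_ifs at h with hex
    rw [← Option.some.inj h]
    exact hex.choose_spec
  · intro h
    have hex : ∃ o, AllOutput P σ ω o := ⟨o, h⟩
    rw [dif_pos hex, hex.choose_spec.unique h]

/-! ### The honest execution -/

omit [NeZero n] in
theorem le_sentCount (i : V n) {r : ℕ} (hr : r ≤ n) : r ≤ sentCount n i r := by
  unfold sentCount
  split_ifs <;> omega

/-- In an honest execution every processor eventually receives `n` messages: when no more messages
are delivered, an incomplete processor has received all that its predecessor has sent, so all have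
received equally many, which is impossible at the successor of the origin. -/
theorem exists_length_received_eq (σ : Schedule n) (ω : V n → RandomString n) :
    ∃ T, ∀ i, ((run (aLeadUni n) σ ω T).received i).length = n := by
  have hD := isDeviation_self (aLeadUni n) ∅
  set R : ℕ → V n → ℕ := fun t i => ((run (aLeadUni n) σ ω t).received i).length with hR
  have hRn : ∀ t i, R t i ≤ n := fun t i => length_received_le hD σ ω t (Finset.notMem_empty i)
  -- From a time `T` that maximizes the total number of deliveries on, nothing is delivered.
  obtain ⟨T, hT⟩ : ∃ T, ∀ t, ∑ i, R t i ≤ ∑ i, R T i := by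
    have hb : BddAbove (Set.range fun t => ∑ i, R t i) :=
      ⟨∑ _i : V n, n, by rintro _ ⟨t, rfl⟩; exact Finset.sum_le_sum fun i _ => hRn t i⟩
    obtain ⟨T, hT⟩ := Nat.sSup_mem (Set.range_nonempty fun t => ∑ i, R t i) hb
    exact ⟨T, fun t => by
      have := le_csSup hb (Set.mem_range_self t)
      simp only at hT
      rwa [← hT] at this⟩
  have hconst : ∀ t, T ≤ t → ∀ i, (run (aLeadUni n) σ ω t).received i =
      (run (aLeadUni n) σ ω T).received i := by
    intro t ht i
    have hle : ∀ i ∈ Finset.univ, R T i ≤ R t i := fun i _ =>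
      (received_mono (aLeadUni n) σ ω ht i).length_le
    have := (Finset.sum_eq_sum_iff_of_le hle).1 (le_antisymm (Finset.sum_le_sum hle) (hT t)) i
      (Finset.mem_univ i)
    exact ((received_mono (aLeadUni n) σ ω ht i).eq_of_length this).symm
  have hpend : ∀ i, R T (i + 1) < n →
      (run (aLeadUni n) σ ω T).pending (i + 1) = [] := by
    intro i hi
    obtain ⟨s, hs, hlink⟩ := σ.fair (i + 1) T
    have h1 := (run_reachable (aLeadUni n) σ ω T).sent i
    have h2 := (run_reachable (aLeadUni n) σ ω s).sent i
    rw [hconst s hs, hconst s hs, ← h1] at h2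
    rw [← List.append_cancel_left h2]
    rcases hp : (run (aLeadUni n) σ ω s).pending (i + 1) with _ | ⟨m, rest⟩
    · rfl
    have ho : (run (aLeadUni n) σ ω s).output (i + 1) = none := by
      rw [(run_reachable (aLeadUni n) σ ω s).out, hconst s hs,
        act_of_notMem hD ω (Finset.notMem_empty _)]
      exact aLeadAct_output_of_lt _ _ hi
    have h3 := hconst (s + 1) (by omega) (i + 1)
    rw [← hconst s hs, run, hlink, deliver_cons _ _ _ _ ho hp] at h3
    simp at h3
  have hstep : ∀ i, R T (i + 1) < n → R T (i + 1) = sentCount n i (R T i) := by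
    intro i hi
    have h1 := (run_reachable (aLeadUni n) σ ω T).sent i
    rw [hpend i hi, List.append_nil,
      transduce_of_notMem hD ω (Finset.notMem_empty i) (hRn T i)] at h1
    have h2 := congrArg List.length h1
    simp only [List.length_map, List.length_take, List.length_cons, length_residues] at h2
    rw [Nat.min_eq_left] at h2
    · exact h2
    · refine (sentCount_le i _).trans ?_
      split_ifs <;> omega
  have hmono : ∀ i, R T i ≤ R T (i + 1) := by
    intro i
    by_cases hi : R T (i + 1) < n
    · rw [hstep i hi]
      exact le_sentCount i (hRn T i)
    · exact (hRn T i).trans (not_lt.1 hi)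
  have hall : ∀ a i, R T a ≤ R T i := by
    intro a i
    obtain ⟨j, -, rfl⟩ := exists_eq_add_natCast a i
    induction j with
    | zero => simp
    | succ j ih =>
      rw [Nat.cast_succ, ← add_assoc]
      exact ih.trans (hmono _)
  have horigin : R T (origin n + 1) = n := by
    by_contra hne
    have hlt := lt_of_le_of_ne (hRn T (origin n + 1)) hne
    have h1 := hstep _ hlt
    have h2 := hall (origin n + 1) (origin n)
    rw [sentCount, if_pos rfl] at h1
    omega
  exact ⟨T, fun i => le_antisymm (hRn T i) (horigin.symm.le.trans (hall (origin n + 1) i))⟩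

/-- In an honest execution all processors output the sum of all secrets. -/
theorem allOutput_aLeadUni (σ : Schedule n) (ω : V n → RandomString n) :
    AllOutput (aLeadUni n) σ ω (∑ i, ω i 0) := by
  have hD := isDeviation_self (aLeadUni n) ∅
  have hn : 0 < n := Nat.pos_of_ne_zero (NeZero.ne n)
  obtain ⟨T, hT⟩ := exists_length_received_eq σ ω
  set X : V n → List (V n) := fun i => residues n ((run (aLeadUni n) σ ω T).received i) with hX
  have hXlen : ∀ i, (X i).length = n := fun i => by simp [hX, hT i]
  have hXstep : ∀ i, X (i + 1) <+: ω i 0 :: X i := by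
    intro i
    have := (received_prefix_of_notMem hD σ ω T (Finset.notMem_empty i)).map
      (Nat.cast : ℕ → V n)
    change X (i + 1) <+: residues n _ at this
    rwa [residues_map_val] at this
  have hget : ∀ m < n, ∀ i, (X i)[m]? = some (ω (i - 1 - (m : ℕ)) 0) := by
    intro m
    induction m with
    | zero =>
      intro hm i
      have h1 := hXstep (i - 1)
      rw [sub_add_cancel] at h1
      have := h1.getElem (i := 0) (by rw [hXlen]; exact hm)
      rw [List.getElem?_eq_getElem (by rw [hXlen]; exact hm), this]
      simp
    | succ m ih =>
      intro hm i
      have h1 := hXstep (i - 1)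
      rw [sub_add_cancel] at h1
      have := h1.getElem (i := m + 1) (by rw [hXlen]; exact hm)
      rw [List.getElem?_eq_getElem (by rw [hXlen]; exact hm), this, List.getElem_cons_succ,
        ← List.getElem?_eq_getElem, ih (by omega)]
      have : i - 1 - 1 - (m : V n) = i - 1 - ((m + 1 : ℕ) : V n) := by push_cast; ring
      rw [this]
  have hXeq : ∀ i, X i = (List.range n).map fun m : ℕ => ω (i - 1 - (m : ℕ)) 0 := by
    intro i
    refine List.ext_getElem? fun m => ?_
    by_cases hm : m < n
    · rw [hget m hm i]
      simp [hm]
    · rw [List.getElem?_eq_none (by rw [hXlen]; omega), List.getElem?_eq_none (by simp; omega)]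
  intro i
  refine ⟨T, ?_⟩
  rw [(run_reachable (aLeadUni n) σ ω T).out i, act_of_notMem hD ω (Finset.notMem_empty i),
    aLeadAct_eq]
  have hlast : (X i).getLast? = some (ω i 0) := by
    rw [List.getLast?_eq_getElem?, hXlen, hget _ (by omega)]
    congr 2
    rw [Nat.cast_sub (by omega), ZMod.natCast_self]
    simp
  have hsum : (X i).sum = ∑ j, ω j 0 := by
    rw [hXeq, ← List.sum_toFinset _ List.nodup_range, List.toFinset_range]
    refine Finset.sum_nbij' (fun m : ℕ => i - 1 - (m : V n)) (fun v => (i - 1 - v).val)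
      (fun _ _ => Finset.mem_univ _) (fun v _ => Finset.mem_range.2 (ZMod.val_lt _)) ?_ ?_
      (fun _ _ => rfl)
    · intro m hm
      simp [ZMod.val_natCast_of_lt (Finset.mem_range.1 hm)]
    · intro v _
      simp
  simp only [hT i, if_true]
  rw [if_pos hlast]
  simp only [← hsum, hX]

end HonestRun

section Probability

variable {n : ℕ}

/-! ### Measurability -/

instance : MeasurableSpace (Action n) := ⊤

instance : MeasurableSpace (Config n) := ⊤

variable [NeZero n]

instance : Countable (Action n) := by
  refine Function.Injective.countable (f := fun a : Action n => (a.send, a.output)) ?_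
  intro a b h
  exact Action.ext (congrArg Prod.fst h) (congrArg Prod.snd h)

instance : Countable (Config n) := by
  refine Function.Injective.countable
    (f := fun c : Config n => (c.received, c.pending, c.output)) ?_
  rintro ⟨r, p, o⟩ ⟨r', p', o'⟩ h
  simp only [Prod.mk.injEq] at h
  obtain ⟨rfl, rfl, rfl⟩ := h
  rfl

theorem measurable_act (P : Protocol n) (i : V n) (h : List ℕ) :
    Measurable fun ω : V n → RandomString n => (P i).act i (ω i) h := by
  refine measurable_to_countable' fun a => ?_
  exact measurable_pi_apply (X := fun _ : V n => RandomString n) i ((P i).measurable_act i h a)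

theorem measurable_run (P : Protocol n) (σ : Schedule n) (t : ℕ) :
    Measurable fun ω => run P σ ω t := by
  induction t with
  | zero =>
    have h1 : Measurable fun (ω : V n → RandomString n) (i : V n) => (P i).act i (ω i) [] :=
      measurable_pi_lambda _ fun i => measurable_act P i []
    have h2 : Measurable fun a : V n → Action n =>
        ({ received := fun _ => []
           pending := fun i => (a (i - 1)).send
           output := fun i => (a i).output } : Config n) := measurable_of_countable _
    exact h2.comp h1
  | succ t ih =>
    have hdel : ∀ i c, Measurable fun ω => Config.deliver P ω i c := by
      intro i c
      by_cases ho : c.output i = none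
      swap
      · simp only [deliver_of_output P _ i c ho]
        exact measurable_const
      rcases hp : c.pending i with _ | ⟨m, rest⟩
      · simp only [deliver_of_pending P _ i c hp]
        exact measurable_const
      simp only [deliver_cons P _ i c ho hp]
      have h2 : Measurable fun a : Action n =>
          ({ received := Function.update c.received i (c.received i ++ [m])
             pending := Function.update (Function.update c.pending i rest) (i + 1)
               (Function.update c.pending i rest (i + 1) ++ a.send)
             output := Function.update c.output i a.output } : Config n) := measurable_from_top
      exact h2.comp (measurable_act P i _)
    refine measurable_to_countable' fun c' => ?_
    have : (fun ω => run P σ ω (t + 1)) ⁻¹' {c'} =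
        ⋃ c, ((fun ω => run P σ ω t) ⁻¹' {c} ∩
          (fun ω => Config.deliver P ω (σ.link t) c) ⁻¹' {c'}) := by
      ext ω
      simp [run]
    rw [this]
    exact MeasurableSet.iUnion fun c => (ih (MeasurableSpace.measurableSet_top)).inter
      (hdel _ c (MeasurableSpace.measurableSet_top))

theorem measurableSet_run (P : Protocol n) (σ : Schedule n) (t : ℕ) (p : Config n → Prop) :
    MeasurableSet {ω | p (run P σ ω t)} :=
  measurable_run P σ t (MeasurableSpace.measurableSet_top (s := {c | p c}))

theorem measurableSet_allOutput (P : Protocol n) (σ : Schedule n) (o : V n) :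
    MeasurableSet {ω | AllOutput P σ ω o} := by
  have : {ω | AllOutput P σ ω o} =
      ⋂ i, ⋃ t, {ω | (run P σ ω t).output i = some (some o)} := by
    ext ω
    simp [AllOutput]
  rw [this]
  exact MeasurableSet.iInter fun i => MeasurableSet.iUnion fun t =>
    measurableSet_run P σ t fun c => c.output i = some (some o)

theorem measurableSet_rushes (D : Protocol n) (σ : Schedule n) (g : ℕ) (q : V n) (l r : ℕ) :
    MeasurableSet {ω | Rushes D σ g q l r ω} := by
  have : {ω | Rushes D σ g q l r ω} = (⋃ o, {ω | AllOutput D σ ω o}) ∩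
      ⋃ t, {ω | ((run D σ ω t).received (q + 1)).length = r ∧
        r + g + 1 ≤ ((run D σ ω t).received (q + 1 + (l : ℕ))).length} := by
    ext ω
    simp [Rushes]
  rw [this]
  exact (MeasurableSet.iUnion fun o => measurableSet_allOutput D σ o).inter
    (MeasurableSet.iUnion fun t => measurableSet_run D σ t fun c =>
      (c.received (q + 1)).length = r ∧ r + g + 1 ≤ (c.received (q + 1 + (l : ℕ))).length)

/-! ### Averaging over the secrets -/

/-- Add `δ i` to the secret of every processor `i`, that is, to the first symbol of its string. -/
def shift (δ : V n → V n) (ω : V n → RandomString n) : V n → RandomString n :=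
  fun i m => ω i m + if m = 0 then δ i else 0

omit [NeZero n] in
theorem shift_apply_zero (δ : V n → V n) (ω : V n → RandomString n) (i : V n) :
    shift δ ω i 0 = ω i 0 + δ i := by
  simp [shift]

omit [NeZero n] in
theorem shift_apply_of_eq {δ δ' : V n → V n} (ω : V n → RandomString n) {i : V n}
    (h : δ i = δ' i) : shift δ ω i = shift δ' ω i := by
  funext m
  simp [shift, h]

theorem map_add_uniform (c : V n) :
    ((PMF.uniformOfFintype (V n)).toMeasure).map (fun x => x + c) =
      (PMF.uniformOfFintype (V n)).toMeasure := by
  refine Measure.ext_of_singleton fun a => ?_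
  have : (fun x : V n => x + c) ⁻¹' {a} = {a - c} := by
    ext x
    exact eq_sub_iff_add_eq.symm
  rw [Measure.map_apply (measurable_of_countable _) (MeasurableSet.singleton a), this,
    PMF.toMeasure_apply_singleton _ _ (MeasurableSet.singleton _),
    PMF.toMeasure_apply_singleton _ _ (MeasurableSet.singleton _)]
  simp

instance : IsProbabilityMeasure (randomness n) := by
  unfold randomness
  infer_instance

theorem measurePreserving_shift (δ : V n → V n) :
    MeasurePreserving (shift δ) (randomness n) (randomness n) := by
  refine measurePreserving_pi (f := fun i (s : RandomString n) m => s m + if m = 0 then δ i else 0)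
    _ _ fun i => ⟨by fun_prop, ?_⟩
  rw [Measure.infinitePi_map_pi (f := fun m (x : V n) => x + if m = 0 then δ i else 0) _
    fun m => measurable_of_countable _]
  simp only [map_add_uniform]

open Classical in
/-- The probability of `E` is the expected proportion of the shifts in `S` that lead into `E`. -/
theorem card_mul_randomness (S : Finset (V n → V n)) {E : Set (V n → RandomString n)}
    (hE : MeasurableSet E) : (S.card : ENNReal) * randomness n E =
      ∫⁻ ω, ((S.filter fun δ => shift δ ω ∈ E).card : ENNReal) ∂(randomness n) := by
  have h1 : ∀ ω, ((S.filter fun δ => shift δ ω ∈ E).card : ENNReal) =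
      ∑ δ ∈ S, (shift δ ⁻¹' E).indicator (fun _ => 1) ω := by
    intro ω
    rw [Finset.card_filter]
    push_cast
    refine Finset.sum_congr rfl fun δ _ => ?_
    simp [Set.indicator_apply]
  simp only [h1]
  rw [lintegral_finsetSum]
  · have h2 : ∀ δ ∈ S, ∫⁻ ω, (shift δ ⁻¹' E).indicator (fun _ => 1) ω ∂(randomness n) =
        randomness n E := by
      intro δ _
      rw [lintegral_indicator ((measurePreserving_shift δ).measurable hE), setLIntegral_one,
        (measurePreserving_shift δ).measure_preimage hE.nullMeasurableSet]
    rw [Finset.sum_congr rfl h2, Finset.sum_const, nsmul_eq_mul]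
  · intro δ _
    exact measurable_const.indicator ((measurePreserving_shift δ).measurable hE)

theorem card_mul_randomness_real_le (S : Finset (V n → V n)) {E : Set (V n → RandomString n)}
    (hE : MeasurableSet E) (N : ℕ)
    (hN : ∀ ω, ∀ A ⊆ S, (∀ δ ∈ A, shift δ ω ∈ E) → A.card ≤ N) :
    (S.card : ℝ) * (randomness n).real E ≤ N := by
  classical
  have h : (S.card : ENNReal) * randomness n E ≤ N := by
    rw [card_mul_randomness S hE]
    calc _ ≤ ∫⁻ _, (N : ENNReal) ∂(randomness n) := lintegral_mono fun ω =>
          Nat.cast_le.2 (hN ω _ (Finset.filter_subset _ _) fun δ hδ => (Finset.mem_filter.1 hδ).2)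
      _ = N := by simp
  have := ENNReal.toReal_mono (ENNReal.natCast_ne_top N) h
  simpa [Measure.real] using this

open Classical in
theorem le_card_mul_randomness_real (S : Finset (V n → V n)) {E : Set (V n → RandomString n)}
    (hE : MeasurableSet E) (N : ℕ)
    (hN : ∀ ω, N ≤ (S.filter fun δ => shift δ ω ∈ E).card) :
    N ≤ (S.card : ℝ) * (randomness n).real E := by
  have h : (N : ENNReal) ≤ (S.card : ENNReal) * randomness n E := by
    rw [card_mul_randomness S hE]
    calc (N : ENNReal) = ∫⁻ _, (N : ENNReal) ∂(randomness n) := by simp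
      _ ≤ _ := lintegral_mono fun ω => Nat.cast_le.2 (hN ω)
  have := ENNReal.toReal_mono
    (ENNReal.mul_ne_top (ENNReal.natCast_ne_top _) (measure_ne_top _ _)) h
  simpa [Measure.real] using this

/-- The shifts of the secret of the single processor `s`. -/
def singleShifts (s : V n) : Finset (V n → V n) :=
  Finset.univ.image fun z : V n => Pi.single s z

theorem card_singleShifts (s : V n) : (singleShifts s).card = n := by
  rw [singleShifts, Finset.card_image_of_injective _ (Pi.single_injective s), Finset.card_univ,
    ZMod.card]

/-- The shifts of the secrets of all processors outside `C`. -/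
def honestShifts (C : Finset (V n)) : Finset (V n → V n) :=
  Fintype.piFinset fun i => if i ∈ C then {0} else Finset.univ

theorem card_honestShifts (C : Finset (V n)) : (honestShifts C).card = n ^ (n - C.card) := by
  rw [honestShifts, Fintype.card_piFinset]
  have : ∀ i : V n, (if i ∈ C then ({0} : Finset (V n)) else Finset.univ).card =
      if i ∈ C then 1 else n := by
    intro i
    split_ifs <;> simp [ZMod.card]
  simp only [this]
  rw [Finset.prod_ite]
  simp only [Finset.prod_const, one_pow, one_mul]
  congr 1
  rw [Finset.filter_not, Finset.card_sdiff_of_subset (Finset.filter_subset _ _)]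
  simp [ZMod.card]

theorem eq_zero_of_mem_honestShifts {C : Finset (V n)} {δ : V n → V n} (h : δ ∈ honestShifts C)
    {i : V n} (hi : i ∈ C) : δ i = 0 := by
  have := Fintype.mem_piFinset.1 h i
  simpa [hi] using this

end Probability

section Bounds

variable {n : ℕ} [NeZero n] {C : Finset (V n)} {D : Protocol n} {σ : Schedule n}
  {ω : V n → RandomString n}

/-! ### Rushing is improbable -/

/-- The history of a gap that rushes by more than `g`, followed by the part of the input of the next
processor which is not a function of it, takes `n - g - 1` symbols and determines all the secrets. -/
theorem card_le_of_rushes (hD : IsDeviation (aLeadUni n) C D) (g : ℕ) {q : V n} {l : ℕ}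
    (hq : IsGap C q l) (r : ℕ) (ω : V n → RandomString n)
    {A : Finset (V n → V n)} (hA : A ⊆ honestShifts C)
    (hrush : ∀ δ ∈ A, Rushes D σ g q l r (shift δ ω)) : A.card ≤ n ^ (n - g - 1) := by
  have hcode : ∀ δ, Rushes D σ g q l r (shift δ ω) →
      ∃ c : List.Vector (V n) (n - g - 1), ∃ o t T, OutputsAt D σ (shift δ ω) o T ∧ t ≤ T ∧
        ((run D σ (shift δ ω) t).received (q + 1)).length = r ∧
        r + g + 1 ≤ ((run D σ (shift δ ω) t).received (q + 1 + (l : ℕ))).length ∧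
        c.toList = residues n ((run D σ (shift δ ω) t).received (q + 1)) ++
          (residues n ((run D σ (shift δ ω) T).received (q + 1 + (l : ℕ)))).drop (r + g + 1) := by
    rintro δ ⟨⟨o, ho⟩, t, hr, hrg⟩
    obtain ⟨T, hT⟩ := ho.exists_time
    have hout : OutputsAt D σ (shift δ ω) o (max t T) := hT _ (le_max_right _ _)
    refine ⟨⟨_, ?_⟩, o, t, max t T, hout, le_max_left _ _, hr, hrg, rfl⟩
    have h1 := length_received_le hD σ (shift δ ω) t hq.right
    rw [List.length_append, List.length_drop, length_residues, length_residues, hr,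
      (received_of_output hD σ _ _ hq.right (hout _)).1]
    omega
  choose! c hc using hcode
  have hcard : Fintype.card (List.Vector (V n) (n - g - 1)) = n ^ (n - g - 1) := by
    rw [card_vector, ZMod.card]
  rw [← hcard, ← Finset.card_univ]
  refine Finset.card_le_card_of_injOn c (fun _ _ => Finset.mem_univ _) ?_
  intro δ hδ δ' hδ' hcc
  obtain ⟨o, t, T, hT, ht, hr, hrg, h1⟩ := hc δ (hrush δ hδ)
  obtain ⟨o', t', T', hT', ht', hr', hrg', h1'⟩ := hc δ' (hrush δ' hδ')
  rw [hcc, h1'] at h1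
  obtain ⟨hin, hout⟩ := List.append_inj h1 (by simp [hr, hr'])
  funext i
  by_cases hi : i ∈ C
  · rw [eq_zero_of_mem_honestShifts (hA hδ) hi, eq_zero_of_mem_honestShifts (hA hδ') hi]
  · have := secret_eq_of_rush hD (fun i hi => shift_apply_of_eq ω (by
      rw [eq_zero_of_mem_honestShifts (hA hδ) hi, eq_zero_of_mem_honestShifts (hA hδ') hi]))
      hT hT' hq ht ht' hrg hrg' hin.symm hout.symm hi
    rw [shift_apply_zero, shift_apply_zero] at this
    exact add_left_cancel this

theorem measure_rushes_le (hD : IsDeviation (aLeadUni n) C D) (g : ℕ) {q : V n} {l : ℕ}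
    (hq : IsGap C q l) (r : ℕ) :
    (n : ℝ) ^ (n - C.card) * (randomness n).real {ω | Rushes D σ g q l r ω} ≤
      (n : ℝ) ^ (n - g - 1) := by
  have := card_mul_randomness_real_le (honestShifts C) (measurableSet_rushes D σ g q l r)
    (n ^ (n - g - 1)) (fun ω _ hA h => card_le_of_rushes hD g hq r ω hA h)
  rw [card_honestShifts] at this
  exact_mod_cast this

/-! ### The distribution of the outcome -/

/-- No gap rushes in the run. -/
def Synchronized (C : Finset (V n)) (D : Protocol n) (σ : Schedule n) (g : ℕ)
    (ω : V n → RandomString n) : Prop :=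
  ∀ q : V n, ∀ l < n, ∀ r < n, IsGap C q l → ¬ Rushes D σ g q l r ω

theorem IsGap.lt {q : V n} {l : ℕ} (hq : IsGap C q l) : l < n := by
  by_contra! hl
  have hn : 0 < n := Nat.pos_of_ne_zero (NeZero.ne n)
  have := hq.mem (n - 1) (by omega)
  rw [Nat.cast_sub (by omega), ZMod.natCast_self] at this
  exact hq.left (by simpa using this)

theorem Synchronized.noRush (hD : IsDeviation (aLeadUni n) C D) {g : ℕ}
    (h : Synchronized C D σ g ω) {o : V n} (ho : AllOutput D σ ω o) : NoRush C D σ g ω := by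
  intro q l t hq
  by_contra! hcon
  have h1 := length_received_le hD σ ω t hq.right
  exact h q l hq.lt _ (by omega) hq ⟨⟨o, ho⟩, t, rfl, by omega⟩

theorem measurableSet_synchronized (C : Finset (V n)) (D : Protocol n) (σ : Schedule n) (g : ℕ) :
    MeasurableSet {ω | Synchronized C D σ g ω} := by
  have : {ω | Synchronized C D σ g ω} =
      ⋂ (q : V n) (l : ℕ) (_ : l < n) (r : ℕ) (_ : r < n) (_ : IsGap C q l),
        {ω | Rushes D σ g q l r ω}ᶜ := by
    ext ω
    simp [Synchronized]
  rw [this]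
  exact .iInter fun q => .iInter fun l => .iInter fun _ => .iInter fun r => .iInter fun _ =>
    .iInter fun _ => (measurableSet_rushes D σ g q l r).compl

/-- Without rushing, every outcome has probability at most `1 / n`. -/
theorem measure_synchronized_le (hD : IsDeviation (aLeadUni n) C D) {g L : ℕ}
    (hL : (g * C.card + 2) * C.card + 2 ≤ L) (hCL : C.card * L < n) (hLn : L ≤ n) (o : V n) :
    (n : ℝ) * (randomness n).real {ω | AllOutput D σ ω o ∧ Synchronized C D σ g ω} ≤ 1 := by
  obtain ⟨s, hs⟩ := exists_segment C hCL
  have hmeas : MeasurableSet {ω | AllOutput D σ ω o ∧ Synchronized C D σ g ω} :=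
    (measurableSet_allOutput D σ o).inter (measurableSet_synchronized C D σ g)
  have := card_mul_randomness_real_le (singleShifts s) hmeas 1 ?_
  · rw [card_singleShifts] at this
    exact_mod_cast this
  intro ω A hA hE
  rw [Finset.card_le_one]
  intro δ hδ δ' hδ'
  obtain ⟨ho, hsync⟩ := hE δ hδ
  obtain ⟨ho', hsync'⟩ := hE δ' hδ'
  obtain ⟨z, -, rfl⟩ := Finset.mem_image.1 (hA hδ)
  obtain ⟨z', -, rfl⟩ := Finset.mem_image.1 (hA hδ')
  obtain ⟨T, hT⟩ := AllOutput.exists_time ho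
  obtain ⟨T', hT'⟩ := AllOutput.exists_time ho'
  have h := NoRush.secret_eq hD (Synchronized.noRush hD hsync ho)
    (Synchronized.noRush hD hsync' ho') (hT T le_rfl) (hT' T' le_rfl) hs hLn hL fun i hi =>
      shift_apply_of_eq ω (by simp [hi])
  rw [shift_apply_zero, shift_apply_zero, Pi.single_eq_same, Pi.single_eq_same] at h
  rw [add_left_cancel h]

/-- Under a deviation, every outcome has probability at most `1 / n` plus the probability of a rush,
which is estimated by a union bound over the gaps, their lengths and the numbers of messages that
they have received. -/
theorem measure_allOutput_le (hD : IsDeviation (aLeadUni n) C D) {g L : ℕ}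
    (hL : (g * C.card + 2) * C.card + 2 ≤ L) (hCL : C.card * L < n) (hLn : L ≤ n) (o : V n) :
    (randomness n).real {ω | AllOutput D σ ω o} ≤
      1 / n + (n : ℝ) ^ 3 * ((n : ℝ) ^ (n - g - 1) / (n : ℝ) ^ (n - C.card)) := by
  have hn : (0 : ℝ) < n := by exact_mod_cast Nat.pos_of_ne_zero (NeZero.ne n)
  have hsub : {ω | AllOutput D σ ω o} ⊆
      {ω | AllOutput D σ ω o ∧ Synchronized C D σ g ω} ∪
        ⋃ x ∈ (Finset.univ : Finset (V n)) ×ˢ (Finset.range n ×ˢ Finset.range n),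
          {ω | IsGap C x.1 x.2.1 ∧ Rushes D σ g x.1 x.2.1 x.2.2 ω} := by
    intro ω ho
    by_cases h : Synchronized C D σ g ω
    · exact Or.inl ⟨ho, h⟩
    · right
      unfold Synchronized at h
      push Not at h
      obtain ⟨q, l, hl, r, hr, hq, hrush⟩ := h
      simp only [Set.mem_iUnion]
      exact ⟨(q, l, r), by simp [hl, hr], hq, hrush⟩
  refine (measureReal_mono hsub).trans ((measureReal_union_le _ _).trans (add_le_add ?_ ?_))
  · rw [le_div_iff₀ hn, mul_comm]
    exact measure_synchronized_le hD hL hCL hLn o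
  · refine (measureReal_biUnion_finset_le _ _).trans ?_
    have hterm : ∀ x ∈ (Finset.univ : Finset (V n)) ×ˢ (Finset.range n ×ˢ Finset.range n),
        (randomness n).real {ω | IsGap C x.1 x.2.1 ∧ Rushes D σ g x.1 x.2.1 x.2.2 ω} ≤
          (n : ℝ) ^ (n - g - 1) / (n : ℝ) ^ (n - C.card) := by
      rintro ⟨q, l, r⟩ -
      by_cases hq : IsGap C q l
      · rw [le_div_iff₀ (by positivity), mul_comm]
        simpa only [hq, true_and] using measure_rushes_le hD g hq r
      · simp only [hq, false_and, Set.ofPred_false, measureReal_empty]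
        positivity
    refine (Finset.sum_le_card_nsmul _ _ _ hterm).trans (le_of_eq ?_)
    rw [Finset.card_product, Finset.card_product, Finset.card_univ, ZMod.card, Finset.card_range,
      nsmul_eq_mul]
    push_cast
    ring

/-- In the honest execution every outcome has probability at least `1 / n`. -/
theorem le_measure_allOutput_aLeadUni (σ : Schedule n) (o : V n) :
    1 / (n : ℝ) ≤ (randomness n).real {ω | AllOutput (aLeadUni n) σ ω o} := by
  classical
  have hn : (0 : ℝ) < n := by exact_mod_cast Nat.pos_of_ne_zero (NeZero.ne n)
  have := le_card_mul_randomness_real (singleShifts (0 : V n))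
    (measurableSet_allOutput (aLeadUni n) σ o) 1 ?_
  · rw [card_singleShifts] at this
    rw [div_le_iff₀ hn, mul_comm]
    exact_mod_cast this
  intro ω
  rw [Nat.one_le_iff_ne_zero, Finset.card_ne_zero]
  refine ⟨Pi.single 0 (o - ∑ i, ω i 0), Finset.mem_filter.2
    ⟨Finset.mem_image_of_mem _ (Finset.mem_univ _), ?_⟩⟩
  have h := allOutput_aLeadUni σ (shift (Pi.single 0 (o - ∑ i, ω i 0)) ω)
  simp only [shift_apply_zero, Finset.sum_add_distrib, Finset.sum_pi_single', Finset.mem_univ,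
    if_true, add_sub_cancel] at h
  exact h

/-! ### Expected utilities -/

theorem expectedUtility_eq (P : Protocol n) (σ : Schedule n) {u : Option (V n) → ℝ}
    (hu : IsRationalUtility u) : expectedUtility P σ u =
      ∑ o, (randomness n).real {ω | AllOutput P σ ω o} * u (some o) := by
  classical
  have h : ∀ ω, u (outcome P σ ω) =
      ∑ o, {ω | AllOutput P σ ω o}.indicator (fun _ => u (some o)) ω := by
    intro ω
    rcases ho : outcome P σ ω with _ | o
    · rw [hu.2, eq_comm]
      refine Finset.sum_eq_zero fun o _ => Set.indicator_of_notMem ?_ _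
      intro h
      rw [outcome_eq_some_iff.2 h] at ho
      cases ho
    · have ho' := outcome_eq_some_iff.1 ho
      rw [Finset.sum_eq_single o]
      · rw [Set.indicator_of_mem ho']
      · intro o' _ hne
        exact Set.indicator_of_notMem (fun h => hne (AllOutput.unique h ho')) _
      · simp
  unfold expectedUtility
  simp only [h]
  rw [integral_finsetSum]
  · refine Finset.sum_congr rfl fun o _ => ?_
    rw [integral_indicator_const _ (measurableSet_allOutput P σ o), smul_eq_mul]
  · intro o _
    exact (integrable_const _).indicator (measurableSet_allOutput P σ o)

/-- If no outcome gains more than `δ` in probability, then no utility gains more than `n * δ`. -/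
theorem expectedUtility_le {P D : Protocol n} {σ : Schedule n} {u : Option (V n) → ℝ}
    (hu : IsRationalUtility u) {p δ : ℝ} (hδ : 0 ≤ δ)
    (hP : ∀ o, p ≤ (randomness n).real {ω | AllOutput P σ ω o})
    (hD : ∀ o, (randomness n).real {ω | AllOutput D σ ω o} ≤ p + δ) :
    expectedUtility D σ u ≤ expectedUtility P σ u + n * δ := by
  rw [expectedUtility_eq D σ hu, expectedUtility_eq P σ hu]
  have hconst : (n : ℝ) * δ = ∑ _o : V n, δ := by
    rw [Finset.sum_const, Finset.card_univ, ZMod.card, nsmul_eq_mul]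
  rw [hconst, ← Finset.sum_add_distrib]
  refine Finset.sum_le_sum fun o _ => ?_
  have h1 := (hu.1 (some o)).1
  have h2 := (hu.1 (some o)).2
  calc _ ≤ ((randomness n).real {ω | AllOutput P σ ω o} + δ) * u (some o) :=
        mul_le_mul_of_nonneg_right ((hD o).trans (by linarith [hP o])) h1
    _ ≤ _ := by nlinarith

end Bounds

end RingElection

theorem mainTheorem2 (n : ℕ) [NeZero n] (k : ℕ) (hk : 1 ≤ k) (k₀ : ℝ)
    (hk₀ : k₀ = (1 / 4 : ℝ) * (n : ℝ) ^ (1 / 4 : ℝ)) (hkk₀ : (k : ℝ) ≤ k₀)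
    (ε : ℝ) (hε : (n : ℝ) ^ (3 : ℕ) * (n : ℝ) ^ (-k₀) ≤ ε) :
    RingElection.IsResilient ε k (RingElection.aLeadUni n) := by
  intro σ u hu C hC D hD
  have hn0 : 0 < n := Nat.pos_of_ne_zero (NeZero.ne n)
  have hn : (0 : ℝ) < n := by exact_mod_cast hn0
  have hn1 : (1 : ℝ) ≤ n := by exact_mod_cast hn0
  have hk1 : (1 : ℝ) ≤ k := by exact_mod_cast hk
  have hk₀1 : 1 ≤ k₀ := hk1.trans hkk₀
  have hn4 : (n : ℝ) = 256 * k₀ ^ 4 := by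
    have : ((n : ℝ) ^ (1 / 4 : ℝ)) ^ (4 : ℕ) = n := by
      rw [← Real.rpow_natCast, ← Real.rpow_mul hn.le]
      norm_num
    rw [hk₀, mul_pow, this]
    ring
  -- With this permitted lead `g`, each rush has probability at most `n ^ (-k₀ - 2)`; the union bound
  -- costs a factor `n ^ 3`, and the sum over the outcomes another factor `n`.
  set K := ⌈k₀⌉₊ with hK
  have hKle : (K : ℝ) ≤ k₀ + 1 := (Nat.ceil_lt_add_one (by linarith)).le
  have hKge : k₀ ≤ K := Nat.le_ceil _
  set g := k + K + 1 with hg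
  set L := (g * k + 2) * k + 2 with hLdef
  have hkL : k * L < n := by
    have hgk : (g : ℝ) * k + 2 ≤ 6 * k₀ ^ 2 := by
      rw [hg]
      push_cast
      have : ((k : ℝ) + K + 1) * k ≤ (4 * k₀) * k₀ :=
        mul_le_mul (by linarith) hkk₀ (by positivity) (by positivity)
      nlinarith
    have hL' : (L : ℝ) ≤ 8 * k₀ ^ 3 := by
      rw [hLdef]
      push_cast
      have : ((g : ℝ) * k + 2) * k ≤ (6 * k₀ ^ 2) * k₀ :=
        mul_le_mul hgk hkk₀ (by positivity) (by positivity)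
      nlinarith [one_le_pow₀ hk₀1 (n := 3)]
    have : (k : ℝ) * L ≤ k₀ * (8 * k₀ ^ 3) :=
      mul_le_mul hkk₀ hL' (by positivity) (by positivity)
    have hlt : (k : ℝ) * L < n := by
      rw [hn4]
      nlinarith [one_le_pow₀ hk₀1 (n := 4)]
    exact_mod_cast hlt
  have hLn : L ≤ n := (Nat.le_mul_of_pos_left L hk).trans hkL.le
  have hgL : g + 1 ≤ n := by
    have : g ≤ g * k := Nat.le_mul_of_pos_right g hk
    have : g * k + 2 ≤ (g * k + 2) * k := Nat.le_mul_of_pos_right _ hk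
    omega
  have hrush : (n : ℝ) * ((n : ℝ) ^ 3 * ((n : ℝ) ^ (n - g - 1) / (n : ℝ) ^ (n - k))) ≤ ε := by
    refine le_trans ?_ hε
    have h1 : (n : ℝ) ^ (n - k) = (n : ℝ) ^ (n - g - 1) * (n : ℝ) ^ (K + 2) := by
      rw [← pow_add]
      congr 1
      omega
    have h2 : (n : ℝ) ^ (n - g - 1) / (n : ℝ) ^ (n - k) = ((n : ℝ) ^ (K + 2))⁻¹ := by
      rw [h1]
      field_simp
    have h3 : (n : ℝ) * ((n : ℝ) ^ 3 * ((n : ℝ) ^ (K + 2))⁻¹) = n ^ 2 * ((n : ℝ) ^ K)⁻¹ := by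
      rw [pow_add]
      field_simp
    rw [h2, h3, ← Real.rpow_natCast (n : ℝ) K, ← Real.rpow_neg hn.le]
    refine mul_le_mul (pow_le_pow_right₀ hn1 (by norm_num)) ?_ (by positivity) (by positivity)
    exact Real.rpow_le_rpow_of_exponent_le hn1 (by linarith)
  obtain ⟨p, hp⟩ : C.Nonempty := Finset.card_pos.1 (by omega)
  refine ⟨p, hp, ?_⟩
  refine (RingElection.expectedUtility_le (hu p) (p := 1 / (n : ℝ))
    (δ := (n : ℝ) ^ 3 * ((n : ℝ) ^ (n - g - 1) / (n : ℝ) ^ (n - k))) (by positivity)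
    (RingElection.le_measure_allOutput_aLeadUni σ) fun o => ?_).trans (by linarith)
  have := RingElection.measure_allOutput_le (σ := σ) hD (g := g) (L := L)
    (by rw [hC]) (by rwa [hC]) hLn o
  rwa [hC] at this
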